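/- Let $n\ge 1$, let $\mathbb B$ be the open unit ball of $\mathbb C^n$ and $A=\{\zeta\in\mathbb C: 1<|\zeta|<e\}$. Let $\varphi_0,\varphi_1$ be real functions on $\overline{\mathbb B}$ that vanish on $\partial\mathbb B$ and are of class $C^{1,1}$ up to the boundary, i.e. continuous on $\overline{\mathbb B}$ and differentiable in $\mathbb B$ with Lipschitz differential. Define $\Psi$ on $\partial(\mathbb B\times A)$ by $\Psi=0$ on $\partial\mathbb B\times\overline A$, $\Psi(z,\zeta)=\varphi_0(z)$ for $z\in\mathbb B$, $|\zeta|=1$, and $\Psi(z,\zeta)=\varphi_1(z)$ for $z\in\mathbb B$, $|\zeta|=e$. Let $\mathcal F$ be the set of functions $u$ that are plurisubharmonic in $\mathbb B\times A$, continuous on $\overline{\mathbb B}\times\overline A$, and satisfy $u\le\Psi$ on $\partial(\mathbb B\times A)$, and let $$\Phi(z,\zeta)=\sup\{u(z,\zeta): u\in\mathcal F\}$$ be the Perron–Bremermann envelope. Then this supremum is finite on $\mathbb B\times A$ (over a non-empty family), and the following hold. For every $\zeta\in A$ the function $\Phi(\cdot,\zeta)$ is differentiable in $\mathbb B$, and its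 real second derivative $D_z^2\Phi(z,\zeta)$ exists for almost every $z\in\mathbb B$; it also exists for almost every $(z,\zeta)\in\mathbb B\times A$. For every compact set $K\subset\mathbb B$ there is a constant $C$, depending only on $K,\varphi_0,\varphi_1$ (and $n$), such that for every $\zeta\in A$ the differential $D_z\Phi(\cdot,\zeta)$ is $C$-Lipschitz on $K$ and $\|D_z^2\Phi(z,\zeta)\|\le C$ for almost every $z\in K$; moreover $D_z^2\Phi$ is measurable on $K\times A$ (up to null sets) and $$\|D_z^2\Phi\|_{L^\infty(K\times A)}\le C .$$ -/

import Mathlib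

open MeasureTheory
open scoped NNReal ENNReal

/-- A continuous plurisubharmonic function on an open subset `U` of a complex normed space:
`u` is continuous on `U` and satisfies the sub-mean value inequality on the boundary circle of
every closed affine complex disc `{a + w b : |w| ≤ 1}` that is contained in `U`. -/
structure IsContPSHOn {V : Type*} [NormedAddCommGroup V] [NormedSpace ℂ V]
    (u : V → ℝ) (U : Set V) : Prop where
  continuousOn : ContinuousOn u U
  le_circleAverage : ∀ a b : V, (∀ w : ℂ, ‖w‖ ≤ 1 → a + w • b ∈ U) →
    u a ≤ Real.circleAverage (fun w : ℂ => u (a + w • b)) 0 1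

/-- The annulus `A = {ζ ∈ ℂ : 1 < |ζ| < e}`. -/
def annulus : Set ℂ := {ζ | 1 < ‖ζ‖ ∧ ‖ζ‖ < Real.exp 1}

/-- `φ` is of class `C^{1,1}` on the closure of the open set `Ω` (to be used for bounded convex
`Ω`): it is continuous on the closure, differentiable in `Ω` over the reals, and its differential
is Lipschitz on `Ω` (hence extends continuously to the closure). -/
structure IsC11On {E : Type*} [NormedAddCommGroup E] [NormedSpace ℝ E]
    (φ : E → ℝ) (Ω : Set E) : Prop where
  continuousOn : ContinuousOn φ (closure Ω)
  differentiableOn : DifferentiableOn ℝ φ Ω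
  lipschitz_fderiv : ∃ L : ℝ≥0, LipschitzOnWith L (fderiv ℝ φ) Ω

section Envelope

variable {E : Type*} [NormedAddCommGroup E] [NormedSpace ℂ E]

open Classical in
/-- The boundary data `Ψ` on `∂(Ω × A)`: it is `0` on `∂Ω × closure A`, equal to `φ₀ z` on
`Ω × {|ζ| = 1}` and to `φ₁ z` on `Ω × {|ζ| = e}`. (Its values elsewhere are never used.) -/
noncomputable def boundaryData (Ω : Set E) (φ₀ φ₁ : E → ℝ) (p : E × ℂ) : ℝ :=
  if p.1 ∈ frontier Ω then 0 else if ‖p.2‖ = 1 then φ₀ p.1 else φ₁ p.1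

/-- The family `𝓕(Ψ, Ω × A)` of plurisubharmonic functions on `Ω × A`, continuous up to the
boundary, with boundary values at most `Ψ` on `∂(Ω × A)`. -/
def subsolutions (Ω : Set E) (Ψ : E × ℂ → ℝ) : Set (E × ℂ → ℝ) :=
  {u | IsContPSHOn u (Ω ×ˢ annulus) ∧ ContinuousOn u (closure Ω ×ˢ closure annulus) ∧
    ∀ p ∈ frontier (Ω ×ˢ annulus), u p ≤ Ψ p}

/-- The Perron–Bremermann envelope `Φ(z, ζ) = sup {u(z, ζ) : u ∈ 𝓕(Ψ, Ω × A)}` of the data `Ψ`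
given by the endpoints `φ₀`, `φ₁`. -/
noncomputable def perronEnvelope (Ω : Set E) (φ₀ φ₁ : E → ℝ) (p : E × ℂ) : ℝ :=
  sSup ((fun u : E × ℂ → ℝ => u p) '' subsolutions Ω (boundaryData Ω φ₀ φ₁))

end Envelope

section Derivatives

variable {E : Type*} [NormedAddCommGroup E] [NormedSpace ℝ E]

/-- The first (real Fréchet) derivative of `Φ(·, ζ)` at `z`. -/
noncomputable def zDeriv (Φ : E × ℂ → ℝ) (ζ : ℂ) (z : E) : E →L[ℝ] ℝ :=
  fderiv ℝ (fun x : E => Φ (x, ζ)) z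

/-- The second (real Fréchet) derivative of `Φ(·, ζ)` at `z`, as a bilinear form; its norm is
the operator norm. -/
noncomputable def zDeriv2 (Φ : E × ℂ → ℝ) (ζ : ℂ) (z : E) : E →L[ℝ] E →L[ℝ] ℝ :=
  fderiv ℝ (zDeriv Φ ζ) z

end Derivatives

/-!
# Interior `C^{1,1}` regularity of a Perron–Bremermann envelope on ball times annulus

The unit ball is homogeneous under its holomorphic automorphisms `ballMoebius a`, which depend
smoothly on the parameter `a`. If `z` is the barycentre of `z₁` and `z₂` with weights `l` and `m`,
two subsolutions `u`, `v` can be transported by the automorphisms that send `z` to `z₁` and to `z₂`,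
and `l * u ∘ T₁ + m * v ∘ T₂` is plurisubharmonic again. On the boundary it exceeds the data by
`O(l * m * ‖z₁ - z₂‖ ^ 2)` only, because the first order terms of the motion cancel and the data are
`C^{1,1}` in `z` (`IsC11On.exists_combination_le`). Lowered by that amount it competes in the
definition of the envelope at `z`; hence `Φ(·, ζ) - C * ‖·‖ ^ 2` is concave on every smaller ball,
with `C` independent of `ζ` (`exists_concaveOn_perronEnvelope`).

Semiconcavity is the upper bound for the second derivative. The lower bound comes from
plurisubharmonicity: as a supremum of plurisubharmonic functions, `Φ(·, ζ)` satisfies the sub-mean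
value inequality on complex lines. The defect of a supergradient inequality for the concave function
`Φ(·, ζ) - C * ‖·‖ ^ 2` is a nonnegative convex function whose circular means are at most
`C * ρ ^ 2` on circles of radius `ρ`, and a nonnegative convex function is controlled by its
circular means. This gives a first order Taylor expansion with error `8 * C * ‖v‖ ^ 2`
(`exists_taylor_of_concaveOn_of_le_circleAverage`), and comparing the expansions at two points shows
that the differential is Lipschitz (`exists_lipschitzOnWith_fderiv`).

Plurisubharmonicity is given as the sub-mean value inequality on affine discs, so its invariance
under holomorphic maps has to be proved (`IsContPSHOn.le_circleAverage_comp`). Smoothing by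
convolution reduces it to `C¹` functions, for which an analytic disc may be replaced by its affine
part up to an error `o(r ^ 2)` in the mean over the circle of radius `r`
(`eventually_le_circleAverage_comp`). The inequality with this error on small circles implies the
inequality on the unit circle, by a maximum principle and the approximation of boundary values by
real parts of polynomials (`le_circleAverage_of_local`).

Finally, for fixed `z` the envelope is lower semicontinuous in `ζ`, and it is equicontinuous in `z`.
Such a family becomes jointly continuous for a finer Polish topology on the parameter space with the
same Borel sets, so that its derivatives are jointly measurable
(`measurable_fderiv_of_equicontinuous`). Rademacher's theorem on the slices and Fubini's theorem
give the existence of the second derivative almost everywhere.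
-/

open Metric Set Filter Topology Polynomial
open scoped Convolution ContDiff

/-! ### Sub-mean value inequalities on the disc -/

/-- Every continuous real function on the unit circle is uniformly approximated by real parts of
complex polynomials. -/
theorem exists_polynomial_re_approx {q : ℂ → ℝ} (hq : ContinuousOn q (sphere 0 1))
    {ε : ℝ} (hε : 0 < ε) :
    ∃ p : ℂ[X], ∀ w ∈ sphere (0 : ℂ) 1, |q w - (p.eval w).re| < ε := by
  have : Fact (0 < 2 * Real.pi) := ⟨Real.two_pi_pos⟩
  have hcirc : Continuous fun t : AddCircle (2 * Real.pi) =>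
      ((AddCircle.toCircle t : Circle) : ℂ) :=
    continuous_subtype_val.comp AddCircle.continuous_toCircle
  have hmem : ∀ t : AddCircle (2 * Real.pi),
      ((AddCircle.toCircle t : Circle) : ℂ) ∈ sphere (0 : ℂ) 1 :=
    fun t => mem_sphere_zero_iff_norm.2 (Circle.norm_coe _)
  have hcont : Continuous fun t : AddCircle (2 * Real.pi) =>
      ((q (AddCircle.toCircle t : Circle) : ℝ) : ℂ) :=
    Complex.continuous_ofReal.comp (hq.comp_continuous hcirc hmem)
  let g : C(AddCircle (2 * Real.pi), ℂ) := ⟨_, hcont⟩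
  -- trigonometric polynomials are dense in the continuous functions on the circle
  have hg : g ∈ (Submodule.span ℂ (range <| @fourier (2 * Real.pi))).topologicalClosure := by
    rw [span_fourier_closure_eq_top]; trivial
  -- a trigonometric polynomial is `P + conj Q` on the circle, with `P` and `Q` polynomials
  have key : ∀ f ∈ Submodule.span ℂ (range <| @fourier (2 * Real.pi)),
      ∃ P Q : ℂ[X], ∀ t, f t = P.eval ((AddCircle.toCircle t : Circle) : ℂ) +
        (starRingEnd ℂ) (Q.eval ((AddCircle.toCircle t : Circle) : ℂ)) := by
    intro f hf
    induction hf using Submodule.span_induction with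
    | mem x hx =>
      obtain ⟨n, rfl⟩ := hx
      rcases n with n | n
      · refine ⟨X ^ n, 0, fun t => ?_⟩
        simp [fourier_apply, AddCircle.toCircle_nsmul]
      · refine ⟨0, X ^ (n + 1), fun t => ?_⟩
        rw [fourier_apply, Int.negSucc_eq, neg_smul, AddCircle.toCircle_neg, Circle.coe_inv_eq_conj]
        have : ((n : ℤ) + 1) = ((n + 1 : ℕ) : ℤ) := by push_cast; ring
        rw [this, AddCircle.toCircle_zsmul, zpow_natCast]
        simp
    | zero => exact ⟨0, 0, fun t => by simp⟩
    | add x y _ _ hx hy =>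
      obtain ⟨P, Q, h⟩ := hx
      obtain ⟨P', Q', h'⟩ := hy
      refine ⟨P + P', Q + Q', fun t => ?_⟩
      simp [h, h']
      ring
    | smul a x _ hx =>
      obtain ⟨P, Q, h⟩ := hx
      refine ⟨C a * P, C ((starRingEnd ℂ) a) * Q, fun t => ?_⟩
      simp [h]
      ring
  obtain ⟨f, hf, hfg⟩ := Metric.mem_closure_iff.1 hg ε hε
  obtain ⟨P, Q, hPQ⟩ := key f hf
  refine ⟨P + Q, fun w hw => ?_⟩
  obtain ⟨t, rfl⟩ : ∃ t : AddCircle (2 * Real.pi), ((AddCircle.toCircle t : Circle) : ℂ) = w := by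
    refine ⟨((Complex.arg w : ℝ) : AddCircle (2 * Real.pi)), ?_⟩
    have hw1 : ‖w‖ = 1 := by simpa using hw
    rw [AddCircle.toCircle_apply_mk]
    have := Complex.norm_mul_exp_arg_mul_I w
    rw [hw1] at this
    simpa using this
  have h1 : ‖g t - f t‖ < ε := by
    have := (ContinuousMap.dist_lt_iff hε).1 hfg t
    rwa [dist_eq_norm] at this
  have h2 : (g t - f t).re = q (AddCircle.toCircle t : Circle) -
      ((P + Q).eval ((AddCircle.toCircle t : Circle) : ℂ)).re := by
    rw [hPQ]; simp [g]
  rw [← h2]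
  exact (Complex.abs_re_le_norm _).trans_lt h1

/-- The circle average of the real part of an entire function is its value at the centre. -/
theorem circleAverage_re_of_differentiable {F : ℂ → ℂ} (hF : Differentiable ℂ F) (c : ℂ) (r : ℝ) :
    Real.circleAverage (fun w => (F w).re) c r = (F c).re := by
  have h1 : Real.circleAverage F c r = F c := hF.diffContOnCl.circleAverage
  have h2 := Complex.reCLM.circleAverage_comp_comm (f := F) (c := c) (R := r)
    (hF.continuous.continuousOn.circleIntegrable')
  rw [h1] at h2
  exact h2

/-- A continuous function on the closed unit disc that satisfies the sub-mean value inequality on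
arbitrarily small circles, up to an error `o(r²)`, satisfies it on the unit circle. -/
theorem le_circleAverage_of_local {h : ℂ → ℝ} (hc : ContinuousOn h (closedBall 0 1))
    (hs : ∀ w₀ ∈ ball (0 : ℂ) 1, ∀ κ > 0, ∀ᶠ r in 𝓝[>] (0 : ℝ),
      h w₀ - κ * r ^ 2 ≤ Real.circleAverage h w₀ r) :
    h 0 ≤ Real.circleAverage h 0 1 := by
  have hint : CircleIntegrable h 0 1 :=
    (hc.mono sphere_subset_closedBall).circleIntegrable zero_le_one
  refine le_of_forall_pos_le_add fun ε hε => ?_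
  -- the approximation error is paid at the centre and on the circle, and the perturbation
  -- `η * ‖w‖ ^ 2` contributes once more: `3 * η ≤ ε`
  have hη : 0 < ε / 4 := by positivity
  set η := ε / 4 with hηdef
  obtain ⟨p, hp⟩ := exists_polynomial_re_approx (hc.mono sphere_subset_closedBall) hη
  -- `k` satisfies a sub-mean value inequality with a gain of order `r ^ 2` that beats the
  -- permitted error, so it has no interior maximum
  set k : ℂ → ℝ := fun w => h w - (p.eval w).re + η * ‖w‖ ^ 2 with hk
  have hkc : ContinuousOn k (closedBall 0 1) := by
    refine (hc.sub ?_).add ?_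
    · exact (Complex.continuous_re.comp p.continuous).continuousOn
    · fun_prop
  obtain ⟨w₀, hw₀, hmax⟩ := (isCompact_closedBall (0 : ℂ) 1).exists_isMaxOn
    ⟨0, by simp⟩ hkc
  have hpcenter : Real.circleAverage (fun w => (p.eval w).re) 0 1 = (p.eval 0).re :=
    circleAverage_re_of_differentiable p.differentiable 0 1
  have hpint : CircleIntegrable (fun w => (p.eval w).re) 0 1 :=
    (Complex.continuous_re.comp p.continuous).continuousOn.circleIntegrable'
  have hple : (p.eval 0).re ≤ Real.circleAverage h 0 1 + η := by
    rw [← hpcenter]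
    have : Real.circleAverage (fun w => h w + η) 0 1 = Real.circleAverage h 0 1 + η := by
      rw [Real.circleAverage_fun_add hint (circleIntegrable_const _ _ _),
        Real.circleAverage_const]
    rw [← this]
    refine Real.circleAverage_mono hpint (hint.add (circleIntegrable_const _ _ _)) ?_
    intro w hw
    have := (abs_lt.1 (hp w (by simpa using hw))).1
    linarith
  have hbd : w₀ ∉ ball (0 : ℂ) 1 := by
    intro hw
    have hev : ∀ᶠ r in 𝓝[>] (0 : ℝ), closedBall w₀ r ⊆ closedBall 0 1 := by
      have hw' : ‖w₀‖ < 1 := by simpa using hw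
      filter_upwards [Ioo_mem_nhdsGT (show (0 : ℝ) < 1 - ‖w₀‖ by linarith)] with r hr
      refine closedBall_subset_closedBall' ?_
      rw [dist_zero_right]; linarith [hr.2]
    obtain ⟨r, ⟨hr1, hr2⟩, hr0⟩ :=
      ((hs w₀ hw (η / 2) (by positivity)).and hev |>.and self_mem_nhdsWithin).exists
    have hr0 : 0 < r := hr0
    have hsub : sphere w₀ |r| ⊆ closedBall 0 1 := by
      rw [abs_of_pos hr0]; exact sphere_subset_closedBall.trans hr2
    -- on the circle, `‖w‖²` is a constant plus a harmonic polynomial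
    set F : ℂ → ℂ := fun w => p.eval w - 2 * η * (starRingEnd ℂ) w₀ * (w - w₀) with hF
    have hFd : Differentiable ℂ F := by fun_prop
    have hFint : CircleIntegrable (fun w => (F w).re) w₀ r :=
      (Complex.continuous_re.comp hFd.continuous).continuousOn.circleIntegrable'
    have hle : ∀ w ∈ sphere w₀ |r|, h w ≤ (F w).re + (h w₀ - (F w₀).re - η * r ^ 2) := by
      intro w hw
      have hkw : k w ≤ k w₀ := hmax (hsub hw)
      have hwr : ‖w - w₀‖ = r := by
        rw [abs_of_pos hr0] at hw; simpa [dist_eq_norm] using hw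
      have hn : ‖w‖ ^ 2 = ‖w₀‖ ^ 2 + r ^ 2 + 2 * ((starRingEnd ℂ) w₀ * (w - w₀)).re := by
        rw [← hwr, ← Complex.normSq_eq_norm_sq, ← Complex.normSq_eq_norm_sq,
          ← Complex.normSq_eq_norm_sq]
        simp [Complex.normSq_apply]; ring
      have e1 : (F w).re = (p.eval w).re - 2 * η * ((starRingEnd ℂ) w₀ * (w - w₀)).re := by
        simp [hF]; ring
      have e2 : (F w₀).re = (p.eval w₀).re := by simp [hF]
      rw [e1, e2]
      simp only [hk] at hkw
      rw [hn] at hkw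
      nlinarith
    have hhint : CircleIntegrable h w₀ r :=
      (hc.mono (by simpa [abs_of_pos hr0] using hsub)).circleIntegrable hr0.le
    have havg := Real.circleAverage_mono hhint
      (hFint.add (circleIntegrable_const (h w₀ - (F w₀).re - η * r ^ 2) _ _)) hle
    rw [show ((fun w => (F w).re) + fun _ => h w₀ - (F w₀).re - η * r ^ 2) =
      fun w => (F w).re + (h w₀ - (F w₀).re - η * r ^ 2) from rfl,
      Real.circleAverage_fun_add hFint (circleIntegrable_const _ _ _),
      Real.circleAverage_const, circleAverage_re_of_differentiable hFd] at havg
    nlinarith [pow_pos hr0 2]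
  have hw₀1 : ‖w₀‖ = 1 := by
    have h1 : ‖w₀‖ ≤ 1 := by simpa using hw₀
    have h2 : ¬ ‖w₀‖ < 1 := by simpa using hbd
    linarith [not_lt.1 h2]
  have hk0 : k 0 ≤ k w₀ := hmax (by simp)
  simp only [hk, hw₀1] at hk0
  have := (abs_lt.1 (hp w₀ (by simpa using hw₀1))).2
  simp at hk0
  linarith

/-! ### Plurisubharmonic functions along analytic discs -/

section AnalyticDiscs

variable {V : Type*} [NormedAddCommGroup V] [NormedSpace ℂ V]

/-- A `C¹` function satisfying the sub-mean value inequality on small affine discs centred at `p`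
satisfies it along every analytic disc through `p`, up to an error `o(r²)`: the quadratic term of
the disc enters the first-order expansion of `v` with mean value zero. -/
theorem eventually_le_circleAverage_comp [CompleteSpace V] {v : V → ℝ} (hv : ContDiff ℝ 1 v)
    {f : ℂ → V} {w₀ : ℂ} (hf : AnalyticAt ℂ f w₀) {δ : ℝ} (hδ : 0 < δ)
    (hsub : ∀ b : V, ‖b‖ < δ → v (f w₀) ≤ Real.circleAverage (fun w => v (f w₀ + w • b)) 0 1)
    {κ : ℝ} (hκ : 0 < κ) :
    ∀ᶠ r in 𝓝[>] (0 : ℝ),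
      v (f w₀) - κ * r ^ 2 ≤ Real.circleAverage (fun w => v (f w)) w₀ r := by
  have hf' := hf
  obtain ⟨P, hP⟩ := hf'
  set p := f w₀ with hp
  set b : V := P.coeff 1 with hb
  set c : V := P.coeff 2 with hc
  set D := fderiv ℝ v p with hD
  -- second order Taylor expansion of the disc
  obtain ⟨M, hM0, hM⟩ : ∃ M > 0, ∀ᶠ w in 𝓝 (0 : ℂ),
      ‖f (w₀ + w) - (p + w • b + w ^ 2 • c)‖ ≤ M * ‖w‖ ^ 3 := by
    obtain ⟨M, hM0, hM⟩ := (hP.isBigO_sub_partialSum_pow 3).exists_pos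
    refine ⟨M, hM0, ?_⟩
    filter_upwards [hM.bound] with w hw
    have e : P.partialSum 3 w = p + w • b + w ^ 2 • c := by
      have h0 : P.coeff 0 = p := hP.coeff_zero _
      simp [FormalMultilinearSeries.partialSum, Finset.sum_range_succ, h0, hb, hc]
    rw [e] at hw
    simpa using hw
  -- the slope error `κ₁` acts on the quadratic term `w ^ 2 • c`; this choice keeps it below
  -- half of the permitted error
  set κ₁ := κ / (2 * (‖c‖ + 1)) with hκ₁
  have hκ₁0 : 0 < κ₁ := by positivity
  have hstrict : HasStrictFDerivAt v D p := hv.contDiffAt.hasStrictFDerivAt one_ne_zero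
  have hlit := hstrict.isLittleO.bound hκ₁0
  have hfc : ContinuousAt (fun w => f (w₀ + w)) 0 := by
    have := hP.continuousAt
    refine ContinuousAt.comp (g := f) ?_ (by fun_prop)
    simpa using this
  have htend : Tendsto (fun w : ℂ => (f (w₀ + w), p + w • b)) (𝓝 0) (𝓝 (p, p)) := by
    refine Tendsto.prodMk_nhds ?_ ?_
    · simpa [ContinuousAt, hp] using hfc
    · have : ContinuousAt (fun w : ℂ => p + w • b) 0 := by fun_prop
      simpa [ContinuousAt] using this
  have hcont : ∀ᶠ w in 𝓝 (0 : ℂ), ContinuousAt f (w₀ + w) := by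
    have h1 : ∀ᶠ w in 𝓝 w₀, ContinuousAt f w := by
      filter_upwards [hf.eventually_analyticAt] with w hw using hw.continuousAt
    have h2 : Tendsto (fun w : ℂ => w₀ + w) (𝓝 0) (𝓝 w₀) := by
      have : ContinuousAt (fun w : ℂ => w₀ + w) 0 := by fun_prop
      simpa [ContinuousAt] using this
    exact h2.eventually h1
  have hall : ∀ᶠ w in 𝓝 (0 : ℂ), ContinuousAt f (w₀ + w) ∧
      v (p + w • b) + D (w ^ 2 • c) - (‖D‖ * M * ‖w‖ ^ 3 + κ₁ * (‖c‖ + M * ‖w‖) * ‖w‖ ^ 2)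
        ≤ v (f (w₀ + w)) := by
    filter_upwards [hM, htend.eventually hlit, hcont] with w h1 h2 h3
    refine ⟨h3, ?_⟩
    set e := f (w₀ + w) - (p + w • b + w ^ 2 • c) with he
    have hx : f (w₀ + w) - (p + w • b) = w ^ 2 • c + e := by rw [he]; abel
    rw [hx, Real.norm_eq_abs] at h2
    have h4 := (abs_le.1 h2).1
    have h5 : ‖w ^ 2 • c + e‖ ≤ (‖c‖ + M * ‖w‖) * ‖w‖ ^ 2 := by
      calc ‖w ^ 2 • c + e‖ ≤ ‖w ^ 2 • c‖ + ‖e‖ := norm_add_le _ _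
        _ ≤ ‖w‖ ^ 2 * ‖c‖ + M * ‖w‖ ^ 3 := by
          rw [norm_smul, norm_pow]; linarith
        _ = _ := by ring
    have h6 : -(‖D‖ * M * ‖w‖ ^ 3) ≤ D e := by
      have : |D e| ≤ ‖D‖ * (M * ‖w‖ ^ 3) :=
        (D.le_opNorm e).trans (mul_le_mul_of_nonneg_left h1 (norm_nonneg _))
      have := (abs_le.1 this).1
      linarith
    have h7 : κ₁ * ‖w ^ 2 • c + e‖ ≤ κ₁ * (‖c‖ + M * ‖w‖) * ‖w‖ ^ 2 := by
      rw [mul_assoc]; exact mul_le_mul_of_nonneg_left h5 hκ₁0.le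
    rw [map_add] at h4
    linarith
  obtain ⟨ρ, hρ0, hρ⟩ := Metric.eventually_nhds_iff.1 hall
  have hsmall : ∀ᶠ r in 𝓝[>] (0 : ℝ), (‖D‖ * M + κ₁ * M) * r < κ / 2 ∧ r * ‖b‖ < δ := by
    have t1 : Tendsto (fun r : ℝ => (‖D‖ * M + κ₁ * M) * r) (𝓝[>] 0) (𝓝 0) := by
      have : ContinuousAt (fun r : ℝ => (‖D‖ * M + κ₁ * M) * r) 0 := by fun_prop
      simpa [ContinuousAt] using this.mono_left nhdsWithin_le_nhds
    have t2 : Tendsto (fun r : ℝ => r * ‖b‖) (𝓝[>] 0) (𝓝 0) := by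
      have : ContinuousAt (fun r : ℝ => r * ‖b‖) 0 := by fun_prop
      simpa [ContinuousAt] using this.mono_left nhdsWithin_le_nhds
    exact (t1.eventually (gt_mem_nhds (half_pos hκ))).and (t2.eventually (gt_mem_nhds hδ))
  filter_upwards [hsmall, Ioo_mem_nhdsGT hρ0] with r hr hrρ
  have hr0 : 0 < r := hrρ.1
  have hb' : ‖(r : ℂ) • b‖ < δ := by
    rw [norm_smul, Complex.norm_real, Real.norm_eq_abs, abs_of_pos hr0]; exact hr.2
  have hvc : Continuous v := hv.continuous
  rw [Real.circleAverage_eq_circleAverage_zero_one]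
  have hnorm : ∀ w ∈ sphere (0 : ℂ) 1, ‖(r : ℂ) * w‖ = r := by
    intro w hw
    have : ‖w‖ = 1 := by simpa using hw
    rw [norm_mul, Complex.norm_real, Real.norm_eq_abs, abs_of_pos hr0, this, mul_one]
  have hin : ∀ w ∈ sphere (0 : ℂ) 1, dist ((r : ℂ) * w) 0 < ρ := by
    intro w hw
    rw [dist_zero_right, hnorm w hw]; exact hrρ.2
  have i1 : CircleIntegrable (fun w : ℂ => v (p + w • (r : ℂ) • b)) 0 1 :=
    ContinuousOn.circleIntegrable' (Continuous.continuousOn (by fun_prop))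
  have i2 : CircleIntegrable (fun w : ℂ => D (((r : ℂ) * w) ^ 2 • c)) 0 1 :=
    ContinuousOn.circleIntegrable' (Continuous.continuousOn (by fun_prop))
  have i2' : CircleIntegrable (fun w : ℂ => ((r : ℂ) * w) ^ 2 • c) 0 1 :=
    ContinuousOn.circleIntegrable' (Continuous.continuousOn (by fun_prop))
  have i3 : CircleIntegrable (fun w : ℂ => v (f (r * w + w₀))) 0 1 := by
    refine ContinuousOn.circleIntegrable zero_le_one fun w hw => ?_
    refine ContinuousAt.continuousWithinAt ?_
    refine hvc.continuousAt.comp ?_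
    refine ContinuousAt.comp (g := f) ?_ (by fun_prop)
    rw [add_comm]
    exact (hρ (hin w hw)).1
  have a2 : Real.circleAverage (fun w : ℂ => D (((r : ℂ) * w) ^ 2 • c)) 0 1 = 0 := by
    have hd : Differentiable ℂ (fun w : ℂ => ((r : ℂ) * w) ^ 2 • c) := by fun_prop
    have h1 : Real.circleAverage (fun w : ℂ => ((r : ℂ) * w) ^ 2 • c) 0 1 = 0 := by
      rw [hd.diffContOnCl.circleAverage]; simp
    have h2 := D.circleAverage_comp_comm i2'
    rw [h1, map_zero] at h2
    exact h2
  set m := ‖D‖ * M * r ^ 3 + κ₁ * (‖c‖ + M * r) * r ^ 2 with hm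
  have hmono := Real.circleAverage_mono ((i1.add i2).add (circleIntegrable_const (-m) 0 1)) i3
    (by
      intro w hw
      have hw' : w ∈ sphere (0 : ℂ) 1 := by simpa using hw
      have h := (hρ (hin w hw')).2
      rw [hnorm w hw', add_comm w₀] at h
      have e : (r * w : ℂ) • b = w • (r : ℂ) • b := by rw [smul_smul, mul_comm]
      rw [e] at h
      simp only [Pi.add_apply]
      linarith)
  have hadd : Real.circleAverage ((((fun w : ℂ => v (p + w • (r : ℂ) • b)) +
      fun w : ℂ => D (((r : ℂ) * w) ^ 2 • c)) + fun _ => -m)) 0 1 =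
      Real.circleAverage (fun w : ℂ => v (p + w • (r : ℂ) • b)) 0 1 + 0 + -m := by
    rw [Real.circleAverage_add (i1.add i2) (circleIntegrable_const _ _ _),
      Real.circleAverage_add i1 i2, a2, Real.circleAverage_const]
  rw [hadd] at hmono
  have h1 := hsub _ hb'
  have h2 : m ≤ κ * r ^ 2 := by
    have e1 : m = ((‖D‖ * M + κ₁ * M) * r + κ₁ * ‖c‖) * r ^ 2 := by rw [hm]; ring
    rw [e1]
    refine mul_le_mul_of_nonneg_right ?_ (by positivity)
    have : κ₁ * ‖c‖ ≤ κ / 2 := by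
      have h8 : κ₁ * (‖c‖ + 1) = κ / 2 := by rw [hκ₁]; field_simp
      linarith
    linarith [hr.1]
  linarith

variable [FiniteDimensional ℂ V]

/-- Convolution with a continuous compactly supported kernel commutes with averaging over the
boundary of an affine disc. -/
theorem circleAverage_integral_mul_sub [MeasurableSpace V] [BorelSpace V]
    (μ : Measure V) [IsLocallyFiniteMeasure μ] [SFinite μ] {φ G : V → ℝ}
    (hφ : Continuous φ) (hφc : HasCompactSupport φ) (hG : Continuous G) (p b : V) :
    Real.circleAverage (fun w : ℂ => ∫ t, φ t * G (p + w • b - t) ∂μ) 0 1 =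
      ∫ t, φ t * Real.circleAverage (fun w : ℂ => G (p - t + w • b)) 0 1 ∂μ := by
  have hcirc : Continuous fun θ : ℝ => circleMap (0 : ℂ) 1 θ := continuous_circleMap 0 1
  have hF : Continuous (Function.uncurry fun (θ : ℝ) (t : V) =>
      φ t * G (p + circleMap 0 1 θ • b - t)) := by
    unfold Function.uncurry
    fun_prop
  have hint : Integrable (Function.uncurry fun (θ : ℝ) (t : V) =>
      φ t * G (p + circleMap 0 1 θ • b - t))
      ((volume.restrict (Ioc 0 (2 * Real.pi))).prod μ) := by
    have h1 : IntegrableOn (Function.uncurry fun (θ : ℝ) (t : V) =>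
      φ t * G (p + circleMap 0 1 θ • b - t)) (Icc 0 (2 * Real.pi) ×ˢ tsupport φ)
        (volume.prod μ) :=
      hF.continuousOn.integrableOn_compact (isCompact_Icc.prod hφc)
    have h2 : IntegrableOn (Function.uncurry fun (θ : ℝ) (t : V) =>
      φ t * G (p + circleMap 0 1 θ • b - t)) (Ioc 0 (2 * Real.pi) ×ˢ univ)
        (volume.prod μ) := by
      refine h1.of_forall_sdiff_eq_zero (measurableSet_Ioc.prod MeasurableSet.univ) ?_
      rintro ⟨θ, t⟩ ⟨ht, ht'⟩
      have : t ∉ tsupport φ := fun h => ht' ⟨Ioc_subset_Icc_self ht.1, h⟩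
      simp [Function.uncurry, image_eq_zero_of_notMem_tsupport this]
    rwa [IntegrableOn, ← Measure.prod_restrict, Measure.restrict_univ] at h2
  unfold Real.circleAverage
  simp only [intervalIntegral.integral_of_le Real.two_pi_pos.le, smul_eq_mul]
  rw [integral_integral_swap hint, ← integral_const_mul]
  refine integral_congr_ae (Eventually.of_forall fun t => ?_)
  simp only
  rw [integral_const_mul]
  simp only [add_sub_right_comm]
  ring

/-- Continuous plurisubharmonic functions satisfy the sub-mean value inequality along all analytic
discs, not only the affine ones. The function is replaced by a convolution, which is `C¹` and
plurisubharmonic near the disc. -/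
theorem IsContPSHOn.le_circleAverage_comp {u : V → ℝ} {U : Set V} (hU : IsOpen U)
    (hu : IsContPSHOn u U) {f : ℂ → V} (hfc : ContinuousOn f (closedBall 0 1))
    (hfd : DifferentiableOn ℂ f (ball 0 1)) (hfU : MapsTo f (closedBall 0 1) U) :
    u (f 0) ≤ Real.circleAverage (fun w => u (f w)) 0 1 := by
  have : CompleteSpace V := FiniteDimensional.complete ℂ V
  have : FiniteDimensional ℝ V := FiniteDimensional.complexToReal V
  have : ProperSpace V := FiniteDimensional.proper ℂ V
  borelize V
  set μ : Measure V := Measure.addHaar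
  set K := f '' closedBall 0 1 with hK
  have hKc : IsCompact K := (isCompact_closedBall 0 1).image_of_continuousOn hfc
  obtain ⟨δ, hδ, hδU⟩ := hKc.exists_cthickening_subset_open hU (image_subset_iff.2 hfU)
  set N := cthickening δ K with hN
  have hNc : IsCompact N := hKc.cthickening
  have huN : ContinuousOn u N := hu.continuousOn.mono hδU
  -- the convolution needs a globally defined function: extend `u` from a neighbourhood of the disc
  obtain ⟨G, hG⟩ := ContinuousMap.exists_restrict_eq hNc.isClosed
    (⟨N.domRestrict u, huN.domRestrict⟩ : C(N, ℝ))
  have hGu : ∀ x ∈ N, G x = u x := fun x hx =>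
    DFunLike.congr_fun hG ⟨x, hx⟩
  have hball : ∀ x ∈ K, closedBall x δ ⊆ N := fun x hx => closedBall_subset_cthickening hx δ
  have huf : ContinuousOn (fun w => u (f w)) (closedBall 0 1) :=
    hu.continuousOn.comp hfc hfU
  have hufi : CircleIntegrable (fun w => u (f w)) 0 1 :=
    (huf.mono sphere_subset_closedBall).circleIntegrable zero_le_one
  refine le_of_forall_pos_le_add fun ε hε => ?_
  obtain ⟨η, hη, hηu⟩ := Metric.uniformContinuousOn_iff.1
    (hNc.uniformContinuousOn_of_continuous G.continuous.continuousOn) (ε / 2) (half_pos hε)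
  set ρ := min η δ / 2 with hρ
  have hmin : 0 < min η δ := lt_min hη hδ
  have hρ0 : 0 < ρ := half_pos hmin
  have hρη : ρ < η := by have := min_le_left η δ; rw [hρ]; linarith
  have hρδ : ρ ≤ δ / 2 := by have := min_le_right η δ; rw [hρ]; linarith
  set φ : ContDiffBump (0 : V) := ⟨ρ / 2, ρ, half_pos hρ0, half_lt_self hρ0⟩ with hφ
  set v : V → ℝ := φ.normed μ ⋆[ContinuousLinearMap.lsmul ℝ ℝ, μ] G with hv
  have hv_eq : ∀ x, v x = ∫ t, φ.normed μ t * G (x - t) ∂μ := fun x => rfl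
  have hvd : ContDiff ℝ 1 v :=
    φ.hasCompactSupport_normed.contDiff_convolution_left _ φ.contDiff_normed
      G.continuous.locallyIntegrable
  have hclose : ∀ x ∈ K, |v x - u x| ≤ ε / 2 := by
    intro x hx
    have hxN : x ∈ N := hball x hx (mem_closedBall_self hδ.le)
    rw [← hGu x hxN, ← Real.dist_eq]
    refine φ.dist_normed_convolution_le G.continuous.aestronglyMeasurable fun y hy => ?_
    have hy' : dist y x < ρ := hy
    have hyN : y ∈ N := hball x hx (by rw [mem_closedBall]; linarith)
    exact (hηu y hyN x hxN (hy'.trans hρη)).le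
  have hvsub : ∀ x ∈ K, ∀ b : V, ‖b‖ < δ / 2 →
      v x ≤ Real.circleAverage (fun w : ℂ => v (x + w • b)) 0 1 := by
    intro x hx b hb
    simp only [hv_eq]
    rw [circleAverage_integral_mul_sub μ φ.continuous_normed φ.hasCompactSupport_normed
      G.continuous]
    have hcirc : Continuous fun t =>
        Real.circleAverage (fun w : ℂ => G (x - t + w • b)) 0 1 := by
      unfold Real.circleAverage
      simp only [smul_eq_mul]
      refine continuous_const.mul ?_
      refine intervalIntegral.continuous_parametric_intervalIntegral_of_continuous' ?_ _ _
      have := continuous_circleMap (0 : ℂ) 1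
      unfold Function.uncurry
      fun_prop
    refine integral_mono_ae ?_ ?_ (Eventually.of_forall fun t => ?_)
    · exact Continuous.integrable_of_hasCompactSupport
        (φ.continuous_normed.mul (by fun_prop)) φ.hasCompactSupport_normed.mul_right
    · exact Continuous.integrable_of_hasCompactSupport
        (φ.continuous_normed.mul hcirc) φ.hasCompactSupport_normed.mul_right
    · by_cases ht : t ∈ Function.support (φ.normed μ)
      · refine mul_le_mul_of_nonneg_left ?_ (φ.nonneg_normed t)
        rw [φ.support_normed_eq, mem_ball_zero_iff] at ht
        have ht' : ‖t‖ < ρ := ht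
        have hmem : ∀ w : ℂ, ‖w‖ ≤ 1 → x - t + w • b ∈ N := by
          intro w hw
          refine hball x hx ?_
          rw [mem_closedBall, dist_eq_norm, show x - t + w • b - x = w • b - t by abel]
          have : ‖w • b‖ ≤ ‖b‖ := by
            rw [norm_smul]; exact mul_le_of_le_one_left (norm_nonneg _) hw
          linarith [norm_sub_le (w • b) t]
        have h0 : G (x - t) = u (x - t) := by
          refine hGu _ ?_
          have := hmem 0 (by simp)
          simpa using this
        rw [h0]
        refine (hu.le_circleAverage (x - t) b fun w hw => hδU (hmem w hw)).trans_eq ?_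
        refine Real.circleAverage_congr_sphere fun w hw => ?_
        have hw1 : ‖w‖ = 1 := by simpa using hw
        exact (hGu _ (hmem w hw1.le)).symm
      · simp only [Function.notMem_support.1 ht, zero_mul, le_refl]
  have hvf : ContinuousOn (fun w => v (f w)) (closedBall 0 1) :=
    hvd.continuous.comp_continuousOn hfc
  have hvfi : CircleIntegrable (fun w => v (f w)) 0 1 :=
    (hvf.mono sphere_subset_closedBall).circleIntegrable zero_le_one
  have hmain : v (f 0) ≤ Real.circleAverage (fun w => v (f w)) 0 1 := by
    refine le_circleAverage_of_local hvf fun w₀ hw₀ κ hκ => ?_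
    have hKw : f w₀ ∈ K := mem_image_of_mem f (ball_subset_closedBall hw₀)
    exact eventually_le_circleAverage_comp hvd (hfd.analyticAt (isOpen_ball.mem_nhds hw₀))
      (half_pos hδ) (hvsub _ hKw) hκ
  have h0 := (abs_le.1 (hclose (f 0) (mem_image_of_mem f (by simp)))).1
  have h1 : Real.circleAverage (fun w => v (f w)) 0 1 ≤
      Real.circleAverage (fun w => u (f w)) 0 1 + ε / 2 := by
    have e : Real.circleAverage (fun w => u (f w) + ε / 2) 0 1 =
        Real.circleAverage (fun w => u (f w)) 0 1 + ε / 2 := by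
      rw [Real.circleAverage_fun_add hufi (circleIntegrable_const _ _ _),
        Real.circleAverage_const]
    rw [← e]
    refine Real.circleAverage_mono hvfi (hufi.add (circleIntegrable_const _ _ _)) fun w hw => ?_
    have hw' : w ∈ closedBall (0 : ℂ) 1 := sphere_subset_closedBall (by simpa using hw)
    have := (abs_le.1 (hclose (f w) (mem_image_of_mem f hw'))).2
    linarith
  linarith

end AnalyticDiscs

/-! ### Automorphisms of the unit ball -/

/-- First order Taylor estimate for a function with Lipschitz derivative on a convex set. -/
theorem norm_sub_sub_fderiv_le_of_lipschitzOnWith {E F : Type*} [NormedAddCommGroup E]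
    [NormedSpace ℝ E] [NormedAddCommGroup F] [NormedSpace ℝ F] {f : E → F} {s : Set E}
    (hs : Convex ℝ s) (hf : ∀ x ∈ s, DifferentiableAt ℝ f x) {L : ℝ≥0}
    (hL : LipschitzOnWith L (fderiv ℝ f) s) {x y : E} (hx : x ∈ s) (hy : y ∈ s) :
    ‖f y - f x - fderiv ℝ f x (y - x)‖ ≤ L * ‖y - x‖ ^ 2 := by
  have hseg : segment ℝ x y ⊆ s := hs.segment_subset hx hy
  have h := (convex_segment x y).norm_image_sub_le_of_norm_hasFDerivWithin_le' (f := f)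
    (f' := fderiv ℝ f) (φ := fderiv ℝ f x) (C := L * ‖y - x‖)
    (fun z hz => (hf z (hseg hz)).hasFDerivAt.hasFDerivWithinAt) (fun z hz => by
      have h1 := hL.dist_le_mul z (hseg hz) x hx
      rw [dist_eq_norm, dist_eq_norm] at h1
      exact h1.trans (mul_le_mul_of_nonneg_left (norm_sub_le_of_mem_segment hz) L.2))
    (left_mem_segment ℝ x y) (right_mem_segment ℝ x y)
  calc _ ≤ _ := h
    _ = _ := by ring

section Moebius

variable {E : Type*} [NormedAddCommGroup E] [InnerProductSpace ℂ E]

/-- The automorphism of the unit ball of a complex inner product space that sends `0` to `a`; for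
`a ≠ 0` it is `(a + P y + √(1 - ‖a‖²) (y - P y)) / (1 + ⟪a, y⟫)`, where `P` is the orthogonal
projection onto `ℂ a`. It is written in a form that is smooth at `a = 0` too. -/
noncomputable def ballMoebius (a y : E) : E :=
  (1 + inner ℂ a y)⁻¹ • (a + ((√(1 - ‖a‖ ^ 2) : ℝ) : ℂ) • y +
    (inner ℂ a y / (1 + (√(1 - ‖a‖ ^ 2) : ℝ) : ℂ)) • a)

theorem one_add_inner_ne_zero {a y : E} (ha : ‖a‖ < 1) (hy : ‖y‖ ≤ 1) :
    (1 : ℂ) + inner ℂ a y ≠ 0 := by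
  intro h
  have h1 : ‖(inner ℂ a y : ℂ)‖ ≤ ‖a‖ * ‖y‖ := norm_inner_le_norm a y
  have h2 : (inner ℂ a y : ℂ) = -1 := by linear_combination h
  rw [h2, norm_neg, norm_one] at h1
  nlinarith [norm_nonneg a]

theorem one_add_ofReal_sqrt_ne_zero (x : ℝ) : (1 : ℂ) + (√x : ℝ) ≠ 0 := by
  have : (0 : ℝ) < 1 + √x := by positivity
  exact_mod_cast this.ne'

theorem ofReal_sqrt_sq_of_norm_lt {E : Type*} [NormedAddCommGroup E] {a : E} (ha : ‖a‖ < 1) :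
    ((√(1 - ‖a‖ ^ 2) : ℝ) : ℂ) ^ 2 = 1 - (‖a‖ : ℂ) ^ 2 := by
  have : (√(1 - ‖a‖ ^ 2)) ^ 2 = 1 - ‖a‖ ^ 2 := Real.sq_sqrt (by nlinarith [norm_nonneg a])
  exact_mod_cast this

@[simp]
theorem ballMoebius_zero_right (a : E) : ballMoebius a 0 = a := by
  simp [ballMoebius]

/-- The automorphism attached to `-a` sends `a` to the centre. -/
theorem ballMoebius_neg_self {a : E} (ha : ‖a‖ < 1) : ballMoebius (-a) a = 0 := by
  have hs := ofReal_sqrt_sq_of_norm_lt ha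
  have h1 := one_add_ofReal_sqrt_ne_zero (1 - ‖a‖ ^ 2)
  unfold ballMoebius
  simp only [norm_neg, inner_neg_left, inner_self_eq_norm_sq_to_K, Complex.coe_algebraMap]
  set s : ℂ := ((√(1 - ‖a‖ ^ 2) : ℝ) : ℂ)
  have e : -a + s • a + (-(‖a‖ : ℂ) ^ 2 / (1 + s)) • -a =
      (-1 + s + (‖a‖ : ℂ) ^ 2 / (1 + s)) • a := by
    simp only [neg_div, neg_smul, smul_neg, neg_neg, add_smul, one_smul]
  rw [e]
  have : -1 + s + (‖a‖ : ℂ) ^ 2 / (1 + s) = 0 := by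
    field_simp
    linear_combination hs
  rw [this]; simp

theorem ballMoebius_ballMoebius_neg {a x : E} (ha : ‖a‖ < 1) (hx : ‖x‖ ≤ 1) :
    ballMoebius a (ballMoebius (-a) x) = x := by
  have hs := ofReal_sqrt_sq_of_norm_lt ha
  have h1 := one_add_ofReal_sqrt_ne_zero (1 - ‖a‖ ^ 2)
  have hd : (1 : ℂ) - inner ℂ a x ≠ 0 := by
    have := one_add_inner_ne_zero (a := -a) (y := x) (by simpa using ha) hx
    rwa [inner_neg_left, ← sub_eq_add_neg] at this
  have hs0 : ((√(1 - ‖a‖ ^ 2) : ℝ) : ℂ) ≠ 0 := by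
    have : 0 < √(1 - ‖a‖ ^ 2) := Real.sqrt_pos.2 (by nlinarith [norm_nonneg a])
    exact_mod_cast this.ne'
  unfold ballMoebius
  simp only [norm_neg, inner_neg_left, inner_smul_right, inner_add_right, inner_neg_right,
    inner_self_eq_norm_sq_to_K, Complex.coe_algebraMap, ← sub_eq_add_neg]
  set s : ℂ := ((√(1 - ‖a‖ ^ 2) : ℝ) : ℂ)
  set t : ℂ := inner ℂ a x
  have hn : (‖a‖ : ℂ) ^ 2 = 1 - s ^ 2 := by linear_combination hs
  rw [hn]
  have e1 : (1 - t)⁻¹ * (-(1 - s ^ 2) + s * t + -t / (1 + s) * -(1 - s ^ 2)) =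
      -1 + s ^ 2 / (1 - t) := by
    field_simp
    ring
  have e2 : (1 : ℂ) + (-1 + s ^ 2 / (1 - t)) = s ^ 2 / (1 - t) := by ring
  rw [e1, e2]
  have e3 : a + s • (1 - t)⁻¹ • (-a + s • x + (-t / (1 + s)) • -a) +
      ((-1 + s ^ 2 / (1 - t)) / (1 + s)) • a =
      (1 + s * (1 - t)⁻¹ * (-1 + t / (1 + s)) + (-1 + s ^ 2 / (1 - t)) / (1 + s)) • a +
        (s ^ 2 / (1 - t)) • x := by
    match_scalars
    · field_simp
    · field_simp
  have e4 : 1 + s * (1 - t)⁻¹ * (-1 + t / (1 + s)) + (-1 + s ^ 2 / (1 - t)) / (1 + s) = 0 := by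
    field_simp
    ring
  rw [e3, e4, zero_smul, zero_add, smul_smul, inv_mul_cancel₀, one_smul]
  exact div_ne_zero (pow_ne_zero 2 hs0) hd

/-- The identity behind the invariance of the unit ball and of the unit sphere. -/
theorem one_sub_norm_sq_ballMoebius {a y : E} (ha : ‖a‖ < 1) (hy : ‖y‖ ≤ 1) :
    (1 - ‖ballMoebius a y‖ ^ 2) * ‖(1 : ℂ) + inner ℂ a y‖ ^ 2 =
      (1 - ‖a‖ ^ 2) * (1 - ‖y‖ ^ 2) := by
  have hd := one_add_inner_ne_zero ha hy
  unfold ballMoebius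
  set σ : ℝ := √(1 - ‖a‖ ^ 2) with hσ
  have hσ0 : 0 ≤ σ := Real.sqrt_nonneg _
  have hσ2 : σ ^ 2 = 1 - ‖a‖ ^ 2 := Real.sq_sqrt (by nlinarith [norm_nonneg a])
  set t : ℂ := inner ℂ a y with ht
  have h1 : (1 : ℝ) + σ ≠ 0 := by positivity
  rw [norm_smul, norm_inv, mul_pow, inv_pow, sub_mul, mul_right_comm,
    inv_mul_cancel₀ (by simpa using hd), one_mul, one_mul]
  set c : ℂ := 1 + t / (1 + σ) with hc
  have e : a + (σ : ℂ) • y + (t / (1 + (σ : ℂ))) • a = c • a + (σ : ℂ) • y := by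
    rw [hc, add_smul, one_smul]; abel
  rw [e, norm_add_sq (𝕜 := ℂ) (c • a), norm_smul, norm_smul, inner_smul_left,
    inner_smul_right, ← ht, Complex.norm_real, Real.norm_eq_abs, abs_of_nonneg hσ0]
  have hcre : c.re = 1 + t.re / (1 + σ) := by
    rw [hc, show (1 + (σ : ℂ)) = ((1 + σ : ℝ) : ℂ) by push_cast; ring, Complex.add_re,
      Complex.div_ofReal_re, Complex.one_re]
  have hcim : c.im = t.im / (1 + σ) := by
    rw [hc, show (1 + (σ : ℂ)) = ((1 + σ : ℝ) : ℂ) by push_cast; ring, Complex.add_im,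
      Complex.div_ofReal_im, Complex.one_im, zero_add]
  rw [mul_pow, mul_pow, ← Complex.normSq_eq_norm_sq c, ← Complex.normSq_eq_norm_sq (1 + t)]
  simp only [Complex.normSq_apply, RCLike.re_to_complex, Complex.mul_re, Complex.mul_im,
    Complex.conj_re, Complex.conj_im, Complex.ofReal_re, Complex.ofReal_im, Complex.add_re,
    Complex.add_im, Complex.one_re, Complex.one_im, hcre, hcim]
  have hn : ‖a‖ ^ 2 = (1 - σ) * (1 + σ) := by linarith
  rw [hn]
  field_simp
  ring

theorem norm_ballMoebius_lt_one {a y : E} (ha : ‖a‖ < 1) (hy : ‖y‖ < 1) :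
    ‖ballMoebius a y‖ < 1 := by
  have h := one_sub_norm_sq_ballMoebius ha hy.le
  have h1 : 0 < ‖(1 : ℂ) + inner ℂ a y‖ ^ 2 :=
    pow_pos (norm_pos_iff.2 (one_add_inner_ne_zero ha hy.le)) 2
  have h2 : 0 < (1 - ‖a‖ ^ 2) * (1 - ‖y‖ ^ 2) :=
    mul_pos (by nlinarith [norm_nonneg a]) (by nlinarith [norm_nonneg y])
  rw [← h] at h2
  have h3 := pos_of_mul_pos_left h2 h1.le
  nlinarith [norm_nonneg (ballMoebius a y)]

theorem norm_ballMoebius_eq_one {a y : E} (ha : ‖a‖ < 1) (hy : ‖y‖ = 1) :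
    ‖ballMoebius a y‖ = 1 := by
  have h := one_sub_norm_sq_ballMoebius ha hy.le
  have h1 : ‖(1 : ℂ) + inner ℂ a y‖ ^ 2 ≠ 0 :=
    pow_ne_zero 2 (norm_ne_zero_iff.2 (one_add_inner_ne_zero ha hy.le))
  rw [hy] at h
  have h3 : 1 - ‖ballMoebius a y‖ ^ 2 = 0 := by
    have : (1 - ‖ballMoebius a y‖ ^ 2) * ‖(1 : ℂ) + inner ℂ a y‖ ^ 2 = 0 := by rw [h]; ring
    exact (mul_eq_zero.1 this).resolve_right h1
  nlinarith [norm_nonneg (ballMoebius a y)]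

theorem differentiableAt_ballMoebius {a y : E} (ha : ‖a‖ < 1) (hy : ‖y‖ ≤ 1) :
    DifferentiableAt ℂ (ballMoebius a) y := by
  have hd := one_add_inner_ne_zero ha hy
  have hi : DifferentiableAt ℂ (fun x : E => (inner ℂ a x : ℂ)) y :=
    (innerSL ℂ a).differentiableAt
  unfold ballMoebius
  refine DifferentiableAt.smul ?_ ?_
  · exact ((differentiableAt_const _).add hi).inv hd
  · refine ((differentiableAt_const _).add (differentiableAt_id.const_smul _)).add ?_
    simp only [div_eq_mul_inv]
    exact (hi.mul_const _).smul_const _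

variable [NormedSpace ℝ E] [IsScalarTower ℝ ℂ E]

/-- Joint smoothness in the parameter and the variable. It holds over the reals only, since the
parameter enters the inner product antilinearly. -/
theorem contDiffOn_ballMoebius :
    ContDiffOn ℝ 2 (fun p : E × E => ballMoebius p.1 p.2)
      {p : E × E | ‖p.1‖ < 1 ∧ (1 : ℂ) + inner ℂ p.1 p.2 ≠ 0} := by
  intro p hp
  refine ContDiffAt.contDiffWithinAt ?_
  have hpos : 1 - ‖p.1‖ ^ 2 ≠ 0 := by nlinarith [norm_nonneg p.1, hp.1]
  have hi : ContDiffAt ℝ 2 (fun p : E × E => (inner ℂ p.1 p.2 : ℂ)) p :=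
    contDiffAt_fst.inner ℂ contDiffAt_snd
  have hs : ContDiffAt ℝ 2 (fun p : E × E => ((√(1 - ‖p.1‖ ^ 2) : ℝ) : ℂ)) p := by
    refine Complex.ofRealCLM.contDiff.contDiffAt.comp p ?_
    exact (contDiffAt_const.sub (contDiffAt_fst.norm_sq ℂ)).sqrt hpos
  unfold ballMoebius
  refine ContDiffAt.smul ((contDiffAt_const.add hi).inv hp.2) ?_
  refine (contDiffAt_fst.add (hs.smul contDiffAt_snd)).add (ContDiffAt.smul ?_ contDiffAt_fst)
  simp only [div_eq_mul_inv]
  exact hi.mul ((contDiffAt_const.add hs).inv (one_add_ofReal_sqrt_ne_zero _))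

/-- First order Taylor estimate for `a ↦ ballMoebius a y`, uniform in `y` up to the boundary. -/
theorem exists_ballMoebius_taylor [FiniteDimensional ℝ E] {r : ℝ} (hr : r < 1) :
    ∃ C : ℝ, 0 ≤ C ∧ ∀ a ∈ closedBall (0 : E) r, ∀ y ∈ closedBall (0 : E) 1,
      ∃ D : E →L[ℝ] E, ‖D‖ ≤ C ∧ ∀ a' ∈ closedBall (0 : E) r,
        ‖ballMoebius a' y - ballMoebius a y - D (a' - a)‖ ≤ C * ‖a' - a‖ ^ 2 := by
  have : ProperSpace E := FiniteDimensional.proper ℝ E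
  set H : E × E → E := fun p => ballMoebius p.1 p.2 with hH
  set Ω : Set (E × E) := {p : E × E | ‖p.1‖ < 1 ∧ (1 : ℂ) + inner ℂ p.1 p.2 ≠ 0} with hΩ
  have hΩo : IsOpen Ω := by
    refine (isOpen_lt continuous_fst.norm continuous_const).inter
      (isOpen_ne_fun ?_ continuous_const)
    exact continuous_const.add (continuous_fst.inner continuous_snd)
  set Q : Set (E × E) := closedBall (0 : E) r ×ˢ closedBall (0 : E) 1 with hQ
  have hQc : IsCompact Q := (isCompact_closedBall _ _).prod (isCompact_closedBall _ _)
  have hQconv : Convex ℝ Q := (convex_closedBall _ _).prod (convex_closedBall _ _)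
  have hQΩ : Q ⊆ Ω := by
    rintro ⟨a, y⟩ ⟨ha, hy⟩
    have ha' : ‖a‖ < 1 := (mem_closedBall_zero_iff.1 ha).trans_lt hr
    exact ⟨ha', one_add_inner_ne_zero ha' (mem_closedBall_zero_iff.1 hy)⟩
  have hc : ContDiffOn ℝ 2 H Ω := contDiffOn_ballMoebius
  have hc1 : ContDiffOn ℝ 1 (fderiv ℝ H) Ω := hc.fderiv_of_isOpen hΩo (by norm_num)
  obtain ⟨C₁, hC₁⟩ := hQc.exists_bound_of_continuousOn (hc1.continuousOn.mono hQΩ)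
  obtain ⟨C₂, hC₂⟩ := hQc.exists_bound_of_continuousOn
    ((ContDiffOn.continuousOn_fderiv_of_isOpen (𝕜 := ℝ) hc1 hΩo le_rfl).mono hQΩ)
  have hLip : LipschitzOnWith C₂.toNNReal (fderiv ℝ H) Q := by
    refine hQconv.lipschitzOnWith_of_nnnorm_fderiv_le (𝕜 := ℝ) (fun x hx => ?_) fun x hx => ?_
    · exact (hc1.contDiffAt (hΩo.mem_nhds (hQΩ hx))).differentiableAt one_ne_zero
    · have := hC₂ x hx
      rw [← NNReal.coe_le_coe, coe_nnnorm]
      exact this.trans (Real.le_coe_toNNReal _)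
  refine ⟨max |C₁| C₂.toNNReal, le_max_of_le_left (abs_nonneg _), fun a ha y hy => ?_⟩
  refine ⟨(fderiv ℝ H (a, y)).comp (ContinuousLinearMap.inl ℝ E E), ?_, fun a' ha' => ?_⟩
  · refine (ContinuousLinearMap.opNorm_comp_le _ _).trans ?_
    calc _ ≤ ‖fderiv ℝ H (a, y)‖ * 1 :=
          mul_le_mul_of_nonneg_left (ContinuousLinearMap.norm_inl_le_one ℝ E E) (norm_nonneg _)
      _ ≤ |C₁| := by rw [mul_one]; exact (hC₁ _ ⟨ha, hy⟩).trans (le_abs_self _)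
      _ ≤ _ := le_max_left _ _
  · have h := norm_sub_sub_fderiv_le_of_lipschitzOnWith hQconv (fun x hx =>
      (hc.contDiffAt (hΩo.mem_nhds (hQΩ hx))).differentiableAt two_ne_zero) hLip
      (x := (a, y)) (y := (a', y)) ⟨ha, hy⟩ ⟨ha', hy⟩
    have e : ((a', y) : E × E) - (a, y) = (a' - a, 0) := by simp
    rw [e] at h
    have en : ‖((a' - a, 0) : E × E)‖ = ‖a' - a‖ := by simp [Prod.norm_def]
    rw [en] at h
    refine h.trans ?_
    exact mul_le_mul_of_nonneg_right (le_max_right _ _) (by positivity)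

end Moebius

/-! ### Plurisubharmonic functions on the product of a domain and the annulus -/

theorem isOpen_annulus : IsOpen annulus :=
  (isOpen_lt continuous_const continuous_norm).inter (isOpen_lt continuous_norm continuous_const)

theorem norm_mem_Icc_of_mem_closure_annulus {ζ : ℂ} (hζ : ζ ∈ closure annulus) :
    1 ≤ ‖ζ‖ ∧ ‖ζ‖ ≤ Real.exp 1 := by
  have hc : IsClosed {ζ : ℂ | 1 ≤ ‖ζ‖ ∧ ‖ζ‖ ≤ Real.exp 1} :=
    (isClosed_le continuous_const continuous_norm).inter
      (isClosed_le continuous_norm continuous_const)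
  have hsub : annulus ⊆ {ζ : ℂ | 1 ≤ ‖ζ‖ ∧ ‖ζ‖ ≤ Real.exp 1} := fun w hw =>
    ⟨hw.1.le, hw.2.le⟩
  exact closure_minimal hsub hc hζ

theorem isCompact_closure_annulus : IsCompact (closure annulus) := by
  refine (isCompact_closedBall (0 : ℂ) (Real.exp 1)).of_isClosed_subset isClosed_closure ?_
  intro ζ hζ
  simpa using (norm_mem_Icc_of_mem_closure_annulus hζ).2

theorem frontier_prod_annulus {E : Type*} [TopologicalSpace E] {Ω : Set E} (hΩ : IsOpen Ω) :
    frontier (Ω ×ˢ annulus) = (closure Ω ×ˢ closure annulus) \ (Ω ×ˢ annulus) := by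
  rw [(hΩ.prod isOpen_annulus).frontier_eq, closure_prod_eq]

section Combination

variable {V : Type*} [NormedAddCommGroup V] [NormedSpace ℂ V]

theorem IsContPSHOn.circleIntegrable {u : V → ℝ} {U : Set V} (hu : IsContPSHOn u U) {a b : V}
    (h : ∀ w : ℂ, ‖w‖ ≤ 1 → a + w • b ∈ U) :
    CircleIntegrable (fun w : ℂ => u (a + w • b)) 0 1 := by
  refine ContinuousOn.circleIntegrable zero_le_one ?_
  refine hu.continuousOn.comp (by fun_prop) fun w hw => h w ?_
  have : ‖w‖ = 1 := by simpa using hw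
  exact this.le

theorem IsContPSHOn.combination {u v : V → ℝ} {U : Set V} (hu : IsContPSHOn u U)
    (hv : IsContPSHOn v U) {l m : ℝ} (hl : 0 ≤ l) (hm : 0 ≤ m) (c : ℝ) :
    IsContPSHOn (fun x => l * u x + m * v x - c) U where
  continuousOn := ((continuousOn_const.mul hu.continuousOn).add
    (continuousOn_const.mul hv.continuousOn)).sub continuousOn_const
  le_circleAverage a b h := by
    have iu := hu.circleIntegrable h
    have iv := hv.circleIntegrable h
    have iu' : CircleIntegrable (fun w : ℂ => l * u (a + w • b)) 0 1 := iu.const_mul l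
    have iv' : CircleIntegrable (fun w : ℂ => m * v (a + w • b)) 0 1 := iv.const_mul m
    have e : Real.circleAverage (fun w : ℂ => l * u (a + w • b) + m * v (a + w • b) - c) 0 1 =
        l * Real.circleAverage (fun w : ℂ => u (a + w • b)) 0 1 +
          m * Real.circleAverage (fun w : ℂ => v (a + w • b)) 0 1 - c := by
      have i : CircleIntegrable (fun w : ℂ => l * u (a + w • b) + m * v (a + w • b)) 0 1 :=
        iu'.add iv'
      rw [Real.circleAverage_fun_sub i (circleIntegrable_const _ _ _),
        Real.circleAverage_fun_add iu' iv', Real.circleAverage_const]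
      congr 2
      · exact Real.circleAverage_fun_smul (a := l) (f := fun w : ℂ => u (a + w • b))
      · exact Real.circleAverage_fun_smul (a := m) (f := fun w : ℂ => v (a + w • b))
    simp only [e]
    have h1 := mul_le_mul_of_nonneg_left (hu.le_circleAverage a b h) hl
    have h2 := mul_le_mul_of_nonneg_left (hv.le_circleAverage a b h) hm
    linarith

end Combination

/-! ### Proper holomorphic maps of the ball -/

/-- A proper holomorphic self-map of the open unit ball that extends continuously to the closed
ball, where the extension preserves the unit sphere. -/
structure IsProperBallMap {E : Type*} [NormedAddCommGroup E] [NormedSpace ℂ E] (T : E → E) :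
    Prop where
  mapsTo_ball : MapsTo T (ball 0 1) (ball 0 1)
  mapsTo_sphere : MapsTo T (sphere 0 1) (sphere 0 1)
  continuousOn : ContinuousOn T (closedBall 0 1)
  differentiableOn : DifferentiableOn ℂ T (ball 0 1)

theorem IsProperBallMap.mapsTo_closedBall {E : Type*} [NormedAddCommGroup E] [NormedSpace ℂ E]
    {T : E → E} (hT : IsProperBallMap T) : MapsTo T (closedBall 0 1) (closedBall 0 1) := by
  rw [← ball_union_sphere]
  exact hT.mapsTo_ball.union_union hT.mapsTo_sphere

theorem IsProperBallMap.comp {E : Type*} [NormedAddCommGroup E] [NormedSpace ℂ E]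
    {S T : E → E} (hS : IsProperBallMap S) (hT : IsProperBallMap T) :
    IsProperBallMap (S ∘ T) where
  mapsTo_ball := hS.mapsTo_ball.comp hT.mapsTo_ball
  mapsTo_sphere := hS.mapsTo_sphere.comp hT.mapsTo_sphere
  continuousOn := hS.continuousOn.comp hT.continuousOn hT.mapsTo_closedBall
  differentiableOn := hS.differentiableOn.comp hT.differentiableOn hT.mapsTo_ball

theorem isProperBallMap_ballMoebius {E : Type*} [NormedAddCommGroup E] [InnerProductSpace ℂ E]
    {a : E} (ha : ‖a‖ < 1) : IsProperBallMap (ballMoebius a) where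
  mapsTo_ball y hy := by
    rw [mem_ball_zero_iff] at *; exact norm_ballMoebius_lt_one ha hy
  mapsTo_sphere y hy := by
    rw [mem_sphere_zero_iff_norm] at *; exact norm_ballMoebius_eq_one ha hy
  continuousOn y hy := by
    rw [mem_closedBall_zero_iff] at hy
    exact (differentiableAt_ballMoebius ha hy).continuousAt.continuousWithinAt
  differentiableOn y hy := by
    rw [mem_ball_zero_iff] at hy
    exact (differentiableAt_ballMoebius ha hy.le).differentiableWithinAt

theorem frontier_unitBall {E : Type*} [NormedAddCommGroup E] [NormedSpace ℝ E] :
    frontier (ball (0 : E) 1) = sphere 0 1 :=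
  frontier_ball 0 one_ne_zero

theorem closure_unitBall {E : Type*} [NormedAddCommGroup E] [NormedSpace ℝ E] :
    closure (ball (0 : E) 1) = closedBall 0 1 :=
  closure_ball 0 one_ne_zero

/-! ### Subsolutions and their envelope -/

section Subsolutions

variable {E : Type*} [NormedAddCommGroup E] [NormedSpace ℂ E]

/-- Plurisubharmonicity on `ball × annulus` is preserved by holomorphic maps of the ball. -/
theorem IsContPSHOn.comp_ballMap [FiniteDimensional ℂ E] {u : E × ℂ → ℝ} {T : E → E}
    (hu : IsContPSHOn u (ball (0 : E) 1 ×ˢ annulus)) (hT : IsProperBallMap T) :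
    IsContPSHOn (fun p : E × ℂ => u (T p.1, p.2)) (ball (0 : E) 1 ×ˢ annulus) where
  continuousOn := by
    refine hu.continuousOn.comp (f := fun p : E × ℂ => (T p.1, p.2)) ?_ ?_
    · exact ((hT.continuousOn.mono ball_subset_closedBall).comp continuousOn_fst
        fun p hp => hp.1).prodMk continuousOn_snd
    · exact fun p hp => ⟨hT.mapsTo_ball hp.1, hp.2⟩
  le_circleAverage a b h := by
    have hdiff : DifferentiableOn ℂ
        (fun w : ℂ => (T (a.1 + w • b.1), a.2 + w • b.2)) (closedBall 0 1) := by
      refine DifferentiableOn.prodMk ?_ (by fun_prop)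
      exact hT.differentiableOn.comp (by fun_prop)
        fun w hw => (h w (by simpa using hw)).1
    have := hu.le_circleAverage_comp (isOpen_ball.prod isOpen_annulus) hdiff.continuousOn
      (hdiff.mono ball_subset_closedBall) fun w hw =>
        ⟨hT.mapsTo_ball (h w (by simpa using hw)).1, (h w (by simpa using hw)).2⟩
    simpa using this

/-- **Maximum principle** for continuous plurisubharmonic functions on `Ω × A`. -/
theorem IsContPSHOn.le_of_frontier_le [ProperSpace E] {Ω : Set E} (hΩ : IsOpen Ω)
    (hΩb : Bornology.IsBounded Ω) {u : E × ℂ → ℝ}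
    (hu : IsContPSHOn u (Ω ×ˢ annulus)) (hc : ContinuousOn u (closure Ω ×ˢ closure annulus))
    {M : ℝ} (hM : ∀ p ∈ frontier (Ω ×ˢ annulus), u p ≤ M) {p : E × ℂ}
    (hp : p ∈ Ω ×ˢ annulus) : u p ≤ M := by
  have hcomp : IsCompact (closure Ω ×ˢ closure annulus) :=
    hΩb.isCompact_closure.prod isCompact_closure_annulus
  have hsub : Ω ×ˢ annulus ⊆ closure Ω ×ˢ closure annulus :=
    prod_mono subset_closure subset_closure
  have hopen : IsOpen (Ω ×ˢ annulus) := hΩ.prod isOpen_annulus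
  have he : 0 < Real.exp 1 ^ 2 := by positivity
  refine le_of_forall_pos_le_add fun ε hε => ?_
  set η := ε / Real.exp 1 ^ 2 with hη
  have hη0 : 0 < η := by positivity
  -- `k` is strictly subharmonic in `ζ`, so it has no interior maximum
  set k : E × ℂ → ℝ := fun q => u q + η * ‖q.2‖ ^ 2 with hk
  have hkc : ContinuousOn k (closure Ω ×ˢ closure annulus) := hc.add (by fun_prop)
  obtain ⟨q, hq, hmax⟩ := hcomp.exists_isMaxOn ⟨p, hsub hp⟩ hkc
  have hqU : q ∉ Ω ×ˢ annulus := by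
    intro hqU
    obtain ⟨ρ, hρ, hρU⟩ := Metric.isOpen_iff.1 hopen q hqU
    set t : ℝ := ρ / 2 with ht
    have ht0 : 0 < t := half_pos hρ
    set b : E × ℂ := (0, (t : ℂ)) with hb
    have hdisc : ∀ w : ℂ, ‖w‖ ≤ 1 → q + w • b ∈ Ω ×ˢ annulus := by
      intro w hw
      refine hρU ?_
      rw [mem_ball, dist_eq_norm, add_sub_cancel_left, norm_smul]
      have : ‖b‖ = t := by simp [hb, Prod.norm_def, abs_of_pos ht0, ht0.le]
      rw [this]
      nlinarith [norm_nonneg w]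
    have hsm := hu.le_circleAverage q b hdisc
    set F : ℂ → ℂ := fun w => -(2 * η * (starRingEnd ℂ) q.2 * (w * t)) with hF
    have hFd : Differentiable ℂ F := by fun_prop
    have hFint : CircleIntegrable (fun w => (F w).re) 0 1 :=
      (Complex.continuous_re.comp hFd.continuous).continuousOn.circleIntegrable'
    have hmono := Real.circleAverage_mono (hu.circleIntegrable hdisc)
      (hFint.add (circleIntegrable_const (u q - η * t ^ 2) _ _)) (by
        intro w hw
        have hw1 : ‖w‖ = 1 := by simpa using hw
        have hle : k (q + w • b) ≤ k q := hmax (hsub (hdisc w hw1.le))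
        have hn : ‖q.2 + w * t‖ ^ 2 = ‖q.2‖ ^ 2 + t ^ 2 +
            2 * ((starRingEnd ℂ) q.2 * (w * t)).re := by
          have h1 : Complex.normSq (w * t) = t ^ 2 := by
            rw [Complex.normSq_eq_norm_sq, norm_mul, hw1, Complex.norm_real, Real.norm_eq_abs,
              one_mul, sq_abs]
          rw [← h1, ← Complex.normSq_eq_norm_sq, ← Complex.normSq_eq_norm_sq]
          simp [Complex.normSq_apply]; ring
        have e2 : (q + w • b).2 = q.2 + w * t := by simp [hb]
        have e1 : (F w).re = -(2 * η * ((starRingEnd ℂ) q.2 * (w * t)).re) := by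
          simp [hF]; ring
        simp only [hk, e2, hn] at hle
        simp only [Pi.add_apply, e1]
        linarith)
    rw [show ((fun w => (F w).re) + fun _ => u q - η * t ^ 2) =
      fun w => (F w).re + (u q - η * t ^ 2) from rfl,
      Real.circleAverage_fun_add hFint (circleIntegrable_const _ _ _),
      Real.circleAverage_const, circleAverage_re_of_differentiable hFd] at hmono
    have hF0 : (F 0).re = 0 := by simp [hF]
    nlinarith [pow_pos ht0 2]
  have hqf : q ∈ frontier (Ω ×ˢ annulus) := by
    rw [frontier_prod_annulus hΩ]; exact ⟨hq, hqU⟩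
  have h1 := hM q hqf
  have h2 : k p ≤ k q := hmax (hsub hp)
  have h3 := (norm_mem_Icc_of_mem_closure_annulus hq.2).2
  have h4 : η * ‖q.2‖ ^ 2 ≤ ε := by
    calc η * ‖q.2‖ ^ 2 ≤ η * Real.exp 1 ^ 2 := by gcongr
      _ = ε := by rw [hη]; field_simp
  have h5 : 0 ≤ η * ‖p.2‖ ^ 2 := by positivity
  simp only [hk] at h2
  linarith

variable [NormedSpace ℝ E] {φ₀ φ₁ : E → ℝ}

theorem abs_boundaryData_le {E : Type*} [NormedAddCommGroup E] [NormedSpace ℝ E]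
    {φ₀ φ₁ : E → ℝ} {M : ℝ} (h₀ : ∀ z ∈ closedBall (0 : E) 1, |φ₀ z| ≤ M)
    (h₁ : ∀ z ∈ closedBall (0 : E) 1, |φ₁ z| ≤ M) {p : E × ℂ}
    (hp : p ∈ frontier (ball (0 : E) 1 ×ˢ annulus)) :
    |boundaryData (ball (0 : E) 1) φ₀ φ₁ p| ≤ M := by
  rw [frontier_prod_annulus isOpen_ball, closure_unitBall] at hp
  have hp1 : p.1 ∈ closedBall (0 : E) 1 := hp.1.1
  unfold boundaryData
  split_ifs
  · rw [abs_zero]; exact (abs_nonneg _).trans (h₀ _ hp1)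
  · exact h₀ _ hp1
  · exact h₁ _ hp1

/-- The family of subsolutions is not empty. -/
theorem const_mem_subsolutions {M : ℝ} (h₀ : ∀ z ∈ closedBall (0 : E) 1, |φ₀ z| ≤ M)
    (h₁ : ∀ z ∈ closedBall (0 : E) 1, |φ₁ z| ≤ M) :
    (fun _ => -M) ∈ subsolutions (ball (0 : E) 1) (boundaryData (ball 0 1) φ₀ φ₁) :=
  ⟨⟨continuousOn_const, fun _ _ _ => by rw [Real.circleAverage_const]⟩, continuousOn_const,
    fun _ hp => (abs_le.1 (abs_boundaryData_le h₀ h₁ hp)).1⟩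

theorem le_of_mem_subsolutions [ProperSpace E] {M : ℝ}
    (h₀ : ∀ z ∈ closedBall (0 : E) 1, |φ₀ z| ≤ M)
    (h₁ : ∀ z ∈ closedBall (0 : E) 1, |φ₁ z| ≤ M) {u : E × ℂ → ℝ}
    (hu : u ∈ subsolutions (ball (0 : E) 1) (boundaryData (ball 0 1) φ₀ φ₁)) {p : E × ℂ}
    (hp : p ∈ ball (0 : E) 1 ×ˢ annulus) : u p ≤ M :=
  hu.1.le_of_frontier_le isOpen_ball isBounded_ball hu.2.1
    (fun q hq => (hu.2.2 q hq).trans (abs_le.1 (abs_boundaryData_le h₀ h₁ hq)).2) hp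

theorem isLUB_perronEnvelope [ProperSpace E] {M : ℝ}
    (h₀ : ∀ z ∈ closedBall (0 : E) 1, |φ₀ z| ≤ M)
    (h₁ : ∀ z ∈ closedBall (0 : E) 1, |φ₁ z| ≤ M) {p : E × ℂ}
    (hp : p ∈ ball (0 : E) 1 ×ˢ annulus) :
    IsLUB ((fun u : E × ℂ → ℝ => u p) ''
      subsolutions (ball (0 : E) 1) (boundaryData (ball 0 1) φ₀ φ₁))
      (perronEnvelope (ball (0 : E) 1) φ₀ φ₁ p) := by
  refine isLUB_csSup ⟨_, mem_image_of_mem _ (const_mem_subsolutions h₀ h₁)⟩ ⟨M, ?_⟩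
  rintro _ ⟨u, hu, rfl⟩
  exact le_of_mem_subsolutions h₀ h₁ hu hp

theorem abs_perronEnvelope_le [ProperSpace E] {M : ℝ}
    (h₀ : ∀ z ∈ closedBall (0 : E) 1, |φ₀ z| ≤ M)
    (h₁ : ∀ z ∈ closedBall (0 : E) 1, |φ₁ z| ≤ M) {p : E × ℂ}
    (hp : p ∈ ball (0 : E) 1 ×ˢ annulus) :
    |perronEnvelope (ball (0 : E) 1) φ₀ φ₁ p| ≤ M := by
  have h := isLUB_perronEnvelope h₀ h₁ hp
  refine abs_le.2 ⟨h.1 (mem_image_of_mem _ (const_mem_subsolutions h₀ h₁)), h.2 ?_⟩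
  rintro _ ⟨u, hu, rfl⟩
  exact le_of_mem_subsolutions h₀ h₁ hu hp

/-- A convex combination of subsolutions, transported by two holomorphic maps of the ball, is a
subsolution again once it is lowered by the amount by which the same combination of the boundary
data exceeds the boundary data. -/
theorem combination_mem_subsolutions [FiniteDimensional ℂ E] {u v : E × ℂ → ℝ}
    (hu : u ∈ subsolutions (ball (0 : E) 1) (boundaryData (ball 0 1) φ₀ φ₁))
    (hv : v ∈ subsolutions (ball (0 : E) 1) (boundaryData (ball 0 1) φ₀ φ₁))
    {T S : E → E} (hT : IsProperBallMap T) (hS : IsProperBallMap S)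
    {l m c : ℝ} (hl : 0 ≤ l) (hm : 0 ≤ m) (hc : 0 ≤ c)
    (h₀ : ∀ x ∈ ball (0 : E) 1, l * φ₀ (T x) + m * φ₀ (S x) ≤ φ₀ x + c)
    (h₁ : ∀ x ∈ ball (0 : E) 1, l * φ₁ (T x) + m * φ₁ (S x) ≤ φ₁ x + c) :
    (fun p : E × ℂ => l * u (T p.1, p.2) + m * v (S p.1, p.2) - c) ∈
      subsolutions (ball (0 : E) 1) (boundaryData (ball 0 1) φ₀ φ₁) := by
  refine ⟨(hu.1.comp_ballMap hT).combination (hv.1.comp_ballMap hS) hl hm c, ?_, ?_⟩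
  · have aux : ∀ {u : E × ℂ → ℝ} {T : E → E}, IsProperBallMap T →
        u ∈ subsolutions (ball (0 : E) 1) (boundaryData (ball 0 1) φ₀ φ₁) →
        ContinuousOn (fun p : E × ℂ => u (T p.1, p.2))
          (closure (ball (0 : E) 1) ×ˢ closure annulus) := by
      intro u T hT hu
      have hcu := hu.2.1
      rw [closure_unitBall] at hcu ⊢
      refine hcu.comp (f := fun p : E × ℂ => (T p.1, p.2)) ?_ ?_
      · exact (hT.continuousOn.comp continuousOn_fst fun p hp => hp.1).prodMk continuousOn_snd
      · exact fun p hp => ⟨hT.mapsTo_closedBall hp.1, hp.2⟩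
    exact ((continuousOn_const.mul (aux hT hu)).add (continuousOn_const.mul (aux hS hv))).sub
      continuousOn_const
  · rintro ⟨z, ζ⟩ hp
    have hp' := hp
    rw [frontier_prod_annulus isOpen_ball, closure_unitBall] at hp'
    obtain ⟨⟨hz, hζ⟩, hn⟩ := hp'
    have hz : z ∈ closedBall (0 : E) 1 := hz
    have hζ : ζ ∈ closure annulus := hζ
    have hfr : ∀ {T : E → E}, IsProperBallMap T →
        (T z, ζ) ∈ frontier (ball (0 : E) 1 ×ˢ annulus) := by
      intro T hT
      rw [frontier_prod_annulus isOpen_ball, closure_unitBall]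
      refine ⟨⟨hT.mapsTo_closedBall hz, hζ⟩, fun hmem => hn ⟨?_, hmem.2⟩⟩
      by_contra hzb
      have hzs : z ∈ sphere (0 : E) 1 := by
        rw [← ball_union_sphere] at hz; exact hz.resolve_left hzb
      have h1 := hT.mapsTo_sphere hzs
      have h2 : T z ∈ ball (0 : E) 1 := hmem.1
      rw [mem_sphere] at h1
      rw [mem_ball] at h2
      linarith
    have hu' := hu.2.2 _ (hfr hT)
    have hv' := hv.2.2 _ (hfr hS)
    have hlu := mul_le_mul_of_nonneg_left hu' hl
    have hmv := mul_le_mul_of_nonneg_left hv' hm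
    unfold boundaryData at hlu hmv ⊢
    -- proper maps preserve the three parts of the boundary, so the same branch of the definition
    -- of the boundary data applies at all points involved
    rw [frontier_unitBall] at *
    by_cases hzs : z ∈ sphere (0 : E) 1
    · simp only [hzs, hT.mapsTo_sphere hzs, hS.mapsTo_sphere hzs, if_true] at hlu hmv ⊢
      linarith
    · have hzb : z ∈ ball (0 : E) 1 := by
        rw [← ball_union_sphere] at hz; exact hz.resolve_right hzs
      have hnot : ∀ {T : E → E}, IsProperBallMap T → T z ∉ sphere (0 : E) 1 := by
        intro T hT h1
        have h2 := hT.mapsTo_ball hzb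
        rw [mem_sphere] at h1
        rw [mem_ball] at h2
        linarith
      simp only [hzs, hnot hT, hnot hS, if_false] at hlu hmv ⊢
      split_ifs at hlu hmv ⊢ with h
      · linarith [h₀ z hzb]
      · linarith [h₁ z hzb]

/-- The envelope inherits the almost convexity of its boundary data along a pair of holomorphic
maps of the ball: the transported combination of near-optimal subsolutions competes at `z`. -/
theorem perronEnvelope_combination_le [FiniteDimensional ℂ E] {M : ℝ}
    (hM₀ : ∀ z ∈ closedBall (0 : E) 1, |φ₀ z| ≤ M)
    (hM₁ : ∀ z ∈ closedBall (0 : E) 1, |φ₁ z| ≤ M)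
    {T S : E → E} (hT : IsProperBallMap T) (hS : IsProperBallMap S)
    {l m c : ℝ} (hl : 0 ≤ l) (hm : 0 ≤ m) (hlm : l + m = 1) (hc : 0 ≤ c)
    (h₀ : ∀ x ∈ ball (0 : E) 1, l * φ₀ (T x) + m * φ₀ (S x) ≤ φ₀ x + c)
    (h₁ : ∀ x ∈ ball (0 : E) 1, l * φ₁ (T x) + m * φ₁ (S x) ≤ φ₁ x + c)
    {z : E} (hz : z ∈ ball (0 : E) 1) {ζ : ℂ} (hζ : ζ ∈ annulus) :
    l * perronEnvelope (ball (0 : E) 1) φ₀ φ₁ (T z, ζ) +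
      m * perronEnvelope (ball (0 : E) 1) φ₀ φ₁ (S z, ζ) ≤
      perronEnvelope (ball (0 : E) 1) φ₀ φ₁ (z, ζ) + c := by
  have : ProperSpace E := FiniteDimensional.proper ℂ E
  have hTz := isLUB_perronEnvelope hM₀ hM₁ (p := (T z, ζ)) ⟨hT.mapsTo_ball hz, hζ⟩
  have hSz := isLUB_perronEnvelope hM₀ hM₁ (p := (S z, ζ)) ⟨hS.mapsTo_ball hz, hζ⟩
  have hzz := isLUB_perronEnvelope hM₀ hM₁ (p := (z, ζ)) ⟨hz, hζ⟩
  refine le_of_forall_pos_le_add fun ε hε => ?_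
  obtain ⟨_, ⟨u, hu, rfl⟩, hu', -⟩ := hTz.exists_between (sub_lt_self _ (half_pos hε))
  obtain ⟨_, ⟨v, hv, rfl⟩, hv', -⟩ := hSz.exists_between (sub_lt_self _ (half_pos hε))
  have h := hzz.1 (mem_image_of_mem (fun u : E × ℂ → ℝ => u (z, ζ))
    (combination_mem_subsolutions hu hv hT hS hl hm hc h₀ h₁))
  have hu1 := mul_le_mul_of_nonneg_left hu'.le hl
  have hv1 := mul_le_mul_of_nonneg_left hv'.le hm
  simp only at h hu1 hv1
  have hε1 : l * (ε / 2) + m * (ε / 2) = ε / 2 := by rw [← add_mul, hlm, one_mul]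
  linarith

/-- The restriction of the envelope to a slice satisfies the sub-mean value inequality wherever it
is continuous. -/
theorem perronEnvelope_le_circleAverage [ProperSpace E] {M : ℝ}
    (h₀ : ∀ z ∈ closedBall (0 : E) 1, |φ₀ z| ≤ M)
    (h₁ : ∀ z ∈ closedBall (0 : E) 1, |φ₁ z| ≤ M) {ζ : ℂ} (hζ : ζ ∈ annulus)
    (hc : ContinuousOn (fun z => perronEnvelope (ball (0 : E) 1) φ₀ φ₁ (z, ζ)) (ball 0 1))
    (a b : E) (hab : ∀ w : ℂ, ‖w‖ ≤ 1 → a + w • b ∈ ball (0 : E) 1) :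
    perronEnvelope (ball (0 : E) 1) φ₀ φ₁ (a, ζ) ≤
      Real.circleAverage (fun w : ℂ =>
        perronEnvelope (ball (0 : E) 1) φ₀ φ₁ (a + w • b, ζ)) 0 1 := by
  have ha : a ∈ ball (0 : E) 1 := by simpa using hab 0 (by simp)
  have hint : CircleIntegrable (fun w : ℂ =>
      perronEnvelope (ball (0 : E) 1) φ₀ φ₁ (a + w • b, ζ)) 0 1 := by
    refine ContinuousOn.circleIntegrable zero_le_one ?_
    refine hc.comp (f := fun w : ℂ => a + w • b) (by fun_prop) fun w hw => hab w ?_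
    exact (mem_sphere_zero_iff_norm.1 hw).le
  refine (isLUB_perronEnvelope h₀ h₁ (p := (a, ζ)) ⟨ha, hζ⟩).2 ?_
  rintro _ ⟨u, hu, rfl⟩
  have hdisc : ∀ w : ℂ, ‖w‖ ≤ 1 → ((a, ζ) : E × ℂ) + w • ((b, 0) : E × ℂ) ∈
      ball (0 : E) 1 ×ˢ annulus := fun w hw => ⟨hab w hw, by simpa using hζ⟩
  refine (hu.1.le_circleAverage (a, ζ) (b, 0) hdisc).trans ?_
  refine Real.circleAverage_mono (hu.1.circleIntegrable hdisc) hint fun w hw => ?_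
  have hw1 : ‖w‖ = 1 := by simpa using hw
  have e : ((a, ζ) : E × ℂ) + w • ((b, 0) : E × ℂ) = (a + w • b, ζ) := by simp
  rw [e]
  exact (isLUB_perronEnvelope h₀ h₁ (p := (a + w • b, ζ)) ⟨hab w hw1.le, hζ⟩).1
    (mem_image_of_mem (fun u : E × ℂ → ℝ => u (a + w • b, ζ)) hu)

/-- For fixed `z` the envelope is lower semicontinuous, hence measurable, in `ζ`. -/
theorem measurable_indicator_perronEnvelope
    [ProperSpace E] {M : ℝ} (h₀ : ∀ z ∈ closedBall (0 : E) 1, |φ₀ z| ≤ M)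
    (h₁ : ∀ z ∈ closedBall (0 : E) 1, |φ₁ z| ≤ M) {z : E}
    (hz : z ∈ ball (0 : E) 1) :
    Measurable (annulus.indicator fun ζ => perronEnvelope (ball (0 : E) 1) φ₀ φ₁ (z, ζ)) := by
  refine measurable_of_Ioi fun c => ?_
  set O : Set ℂ := ⋃ u ∈ subsolutions (ball (0 : E) 1) (boundaryData (ball 0 1) φ₀ φ₁),
    annulus ∩ (fun ζ => u (z, ζ)) ⁻¹' Ioi c with hO
  have hOo : IsOpen O := by
    refine isOpen_biUnion fun u hu => ?_
    refine ContinuousOn.isOpen_inter_preimage ?_ isOpen_annulus isOpen_Ioi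
    exact hu.1.continuousOn.comp (f := fun ζ : ℂ => (z, ζ)) (by fun_prop) fun ζ hζ => ⟨hz, hζ⟩
  have heq : (annulus.indicator fun ζ => perronEnvelope (ball (0 : E) 1) φ₀ φ₁ (z, ζ)) ⁻¹' Ioi c =
      O ∪ (annulusᶜ ∩ {_ζ | c < 0}) := by
    ext ζ
    by_cases hζ : ζ ∈ annulus
    · have hlub := isLUB_perronEnvelope h₀ h₁ (p := (z, ζ)) ⟨hz, hζ⟩
      have := lt_isLUB_iff hlub (b := c)
      simp [hζ, hO, this]
    · simp [hζ, hO]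
  rw [heq]
  exact hOo.measurableSet.union
    (isOpen_annulus.measurableSet.compl.inter (MeasurableSet.const _))

end Subsolutions

/-! ### Semiconcavity of the envelope -/

theorem IsC11On.exists_abs_le {E : Type*} [NormedAddCommGroup E] [NormedSpace ℝ E] [ProperSpace E]
    {φ : E → ℝ} (hφ : IsC11On φ (ball (0 : E) 1)) :
    ∃ M, ∀ z ∈ closedBall (0 : E) 1, |φ z| ≤ M := by
  have h := hφ.continuousOn
  rw [closure_unitBall] at h
  exact (isCompact_closedBall (0 : E) 1).exists_bound_of_continuousOn h

section Envelope

variable {E : Type*} [NormedAddCommGroup E] [InnerProductSpace ℂ E]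
  [NormedSpace ℝ E] [IsScalarTower ℝ ℂ E]

/-- Let `z` be the barycentre of `z₁` and `z₂` with weights `l` and `m`. The automorphisms
`ballMoebius zᵢ ∘ ballMoebius (-z)` send `z` to `zᵢ`, and the mean of the values of `φ` along them
exceeds `φ` by at most a multiple of the variance `l * m * ‖z₁ - z₂‖ ^ 2`: the terms of first order
in `zᵢ - z` cancel. -/
theorem IsC11On.exists_combination_le [FiniteDimensional ℝ E] {φ : E → ℝ}
    (hφ : IsC11On φ (ball (0 : E) 1)) {r : ℝ} (hr : r < 1) :
    ∃ C : ℝ, 0 ≤ C ∧ ∀ z₁ ∈ closedBall (0 : E) r, ∀ z₂ ∈ closedBall (0 : E) r, ∀ l m : ℝ,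
      0 ≤ l → 0 ≤ m → l + m = 1 → ∀ x ∈ ball (0 : E) 1,
      l * φ (ballMoebius z₁ (ballMoebius (-(l • z₁ + m • z₂)) x)) +
        m * φ (ballMoebius z₂ (ballMoebius (-(l • z₁ + m • z₂)) x)) ≤
      φ x + C * (l * m * ‖z₁ - z₂‖ ^ 2) := by
  obtain ⟨L, hL⟩ := hφ.lipschitz_fderiv
  obtain ⟨C, hC0, hC⟩ := exists_ballMoebius_taylor (E := E) hr
  set M : ℝ := ‖fderiv ℝ φ 0‖ + L with hM
  have hM0 : 0 ≤ M := by positivity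
  have hdiff : ∀ x ∈ ball (0 : E) 1, DifferentiableAt ℝ φ x := fun x hx =>
    (hφ.differentiableOn x hx).differentiableAt (isOpen_ball.mem_nhds hx)
  have hDM : ∀ x ∈ ball (0 : E) 1, ‖fderiv ℝ φ x‖ ≤ M := by
    intro x hx
    have h1 := hL.dist_le_mul x hx 0 (mem_ball_self one_pos)
    rw [dist_eq_norm, dist_zero_right] at h1
    have h2 : (L : ℝ) * ‖x‖ ≤ L := by
      refine mul_le_of_le_one_right L.2 ?_
      exact (mem_ball_zero_iff.1 hx).le
    have h3 := norm_sub_norm_le (fderiv ℝ φ x) (fderiv ℝ φ 0)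
    rw [hM]; linarith
  refine ⟨M * C + L * (3 * C) ^ 2, by positivity, ?_⟩
  intro z₁ hz₁ z₂ hz₂ l m hl hm hlm x hx
  set z := l • z₁ + m • z₂ with hz
  have hzr : z ∈ closedBall (0 : E) r := (convex_closedBall (0 : E) r) hz₁ hz₂ hl hm hlm
  have hz1 : ‖z‖ < 1 := (mem_closedBall_zero_iff.1 hzr).trans_lt hr
  have hx1 : ‖x‖ < 1 := mem_ball_zero_iff.1 hx
  set y := ballMoebius (-z) x with hy
  have hy1 : ‖y‖ < 1 := norm_ballMoebius_lt_one (by simpa using hz1) hx1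
  have hTy : ballMoebius z y = x := ballMoebius_ballMoebius_neg hz1 hx1.le
  obtain ⟨D, hD, hDt⟩ := hC z hzr y (mem_closedBall_zero_iff.2 hy1.le)
  rw [hTy] at hDt
  -- expand `φ` along the motion `z' ↦ ballMoebius z' y`, which passes through `x` at `z' = z`
  have key : ∀ z' ∈ closedBall (0 : E) r, φ (ballMoebius z' y) ≤
      φ x + fderiv ℝ φ x (D (z' - z)) + (M * C + L * (3 * C) ^ 2) * ‖z' - z‖ ^ 2 := by
    intro z' hz'
    have hz'1 : ‖z'‖ < 1 := (mem_closedBall_zero_iff.1 hz').trans_lt hr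
    have hmem : ballMoebius z' y ∈ ball (0 : E) 1 :=
      mem_ball_zero_iff.2 (norm_ballMoebius_lt_one hz'1 hy1)
    have h1 := norm_sub_sub_fderiv_le_of_lipschitzOnWith (convex_ball (0 : E) 1) hdiff hL hx hmem
    have h2 := hDt z' hz'
    set e := ballMoebius z' y - x - D (z' - z) with he
    have h3 : ballMoebius z' y - x = D (z' - z) + e := by rw [he]; abel
    have hle2 : ‖z' - z‖ ≤ 2 := (norm_sub_le _ _).trans (by linarith)
    have h4 : ‖D (z' - z) + e‖ ≤ 3 * C * ‖z' - z‖ := by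
      calc ‖D (z' - z) + e‖ ≤ ‖D (z' - z)‖ + ‖e‖ := norm_add_le _ _
        _ ≤ C * ‖z' - z‖ + C * ‖z' - z‖ ^ 2 :=
          add_le_add (D.le_of_opNorm_le hD _) h2
        _ ≤ C * ‖z' - z‖ + C * (2 * ‖z' - z‖) := by
          gcongr
          rw [pow_two]; gcongr
        _ = _ := by ring
    rw [h3] at h1
    have h5 := (abs_le.1 h1).2
    have h6 : fderiv ℝ φ x e ≤ M * (C * ‖z' - z‖ ^ 2) :=
      (le_abs_self _).trans (((fderiv ℝ φ x).le_of_opNorm_le (hDM x hx) e).trans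
        (mul_le_mul_of_nonneg_left h2 hM0))
    have h7 : (L : ℝ) * ‖D (z' - z) + e‖ ^ 2 ≤ L * (3 * C * ‖z' - z‖) ^ 2 := by gcongr
    rw [map_add] at h5
    nlinarith
  have e1 : z₁ - z = m • (z₁ - z₂) := by
    have : m = 1 - l := by linarith
    rw [hz, this]; module
  have e2 : z₂ - z = -(l • (z₁ - z₂)) := by
    have : m = 1 - l := by linarith
    rw [hz, this]; module
  have k1 := mul_le_mul_of_nonneg_left (key z₁ hz₁) hl
  have k2 := mul_le_mul_of_nonneg_left (key z₂ hz₂) hm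
  rw [e1, map_smul, map_smul, norm_smul, Real.norm_of_nonneg hm, smul_eq_mul] at k1
  rw [e2, map_neg, map_neg, map_smul, map_smul, norm_neg, norm_smul, Real.norm_of_nonneg hl,
    smul_eq_mul] at k2
  have hφx : l * φ x + m * φ x = φ x := by rw [← add_mul, hlm, one_mul]
  have hvar : l * (m * ‖z₁ - z₂‖) ^ 2 + m * (l * ‖z₁ - z₂‖) ^ 2 = l * m * ‖z₁ - z₂‖ ^ 2 := by
    have : m = 1 - l := by linarith
    rw [this]; ring
  rw [← hvar]
  nlinarith

/-- The variance identity, in a complex inner product space with its real scalars. -/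
theorem norm_sq_combination {l m : ℝ} (hlm : l + m = 1) (x y : E) :
    l * ‖x‖ ^ 2 + m * ‖y‖ ^ 2 - ‖l • x + m • y‖ ^ 2 = l * m * ‖x - y‖ ^ 2 := by
  have hm : m = 1 - l := by linarith
  have h : ∀ (a : ℝ) (x : E), a • x = (a : ℂ) • x := fun a x => (RCLike.real_smul_eq_coe_smul a x)
  rw [h l, h m, norm_add_sq (𝕜 := ℂ), norm_sub_sq (𝕜 := ℂ), norm_smul, norm_smul, mul_pow, mul_pow,
    inner_smul_left, inner_smul_right, Complex.norm_real, Complex.norm_real, Real.norm_eq_abs,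
    Real.norm_eq_abs, sq_abs, sq_abs, Complex.conj_ofReal, RCLike.re_to_complex,
    RCLike.re_to_complex, Complex.re_ofReal_mul, Complex.re_ofReal_mul, hm]
  ring

variable {φ₀ φ₁ : E → ℝ}

/-- The envelope is semiconcave in `z`, uniformly in `ζ`, on every smaller ball. -/
theorem exists_concaveOn_perronEnvelope [FiniteDimensional ℂ E]
    (h₀ : IsC11On φ₀ (ball (0 : E) 1)) (h₁ : IsC11On φ₁ (ball (0 : E) 1))
    {r : ℝ} (hr : r < 1) :
    ∃ C : ℝ, 0 ≤ C ∧ ∀ ζ ∈ annulus, ConcaveOn ℝ (closedBall (0 : E) r)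
      fun z => perronEnvelope (ball (0 : E) 1) φ₀ φ₁ (z, ζ) - C * ‖z‖ ^ 2 := by
  have : ProperSpace E := FiniteDimensional.proper ℂ E
  have : FiniteDimensional ℝ E := Module.Finite.trans ℂ E
  obtain ⟨C₀, hC₀0, hC₀⟩ := h₀.exists_combination_le hr
  obtain ⟨C₁, hC₁0, hC₁⟩ := h₁.exists_combination_le hr
  obtain ⟨M₀, hM₀⟩ := h₀.exists_abs_le
  obtain ⟨M₁, hM₁⟩ := h₁.exists_abs_le
  refine ⟨max C₀ C₁, le_max_of_le_left hC₀0, fun ζ hζ => ⟨convex_closedBall _ _, ?_⟩⟩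
  intro z₁ hz₁ z₂ hz₂ l m hl hm hlm
  have hzr : l • z₁ + m • z₂ ∈ closedBall (0 : E) r :=
    (convex_closedBall (0 : E) r) hz₁ hz₂ hl hm hlm
  set z := l • z₁ + m • z₂ with hz
  have lt1 : ∀ {x : E}, x ∈ closedBall (0 : E) r → ‖x‖ < 1 := fun hx =>
    (mem_closedBall_zero_iff.1 hx).trans_lt hr
  have hMoeb : ∀ {x : E}, x ∈ closedBall (0 : E) r →
      IsProperBallMap (ballMoebius x ∘ ballMoebius (-z)) := fun hx =>
    (isProperBallMap_ballMoebius (lt1 hx)).comp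
      (isProperBallMap_ballMoebius (by simpa using lt1 hzr))
  have hv : 0 ≤ l * m * ‖z₁ - z₂‖ ^ 2 := by positivity
  have h := perronEnvelope_combination_le
    (fun x hx => (hM₀ x hx).trans (le_max_left M₀ M₁))
    (fun x hx => (hM₁ x hx).trans (le_max_right M₀ M₁))
    (hMoeb hz₁) (hMoeb hz₂) hl hm hlm (c := max C₀ C₁ * (l * m * ‖z₁ - z₂‖ ^ 2))
    (mul_nonneg (le_max_of_le_left hC₀0) hv)
    (fun x hx => (hC₀ z₁ hz₁ z₂ hz₂ l m hl hm hlm x hx).trans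
      (add_le_add le_rfl (mul_le_mul_of_nonneg_right (le_max_left _ _) hv)))
    (fun x hx => (hC₁ z₁ hz₁ z₂ hz₂ l m hl hm hlm x hx).trans
      (add_le_add le_rfl (mul_le_mul_of_nonneg_right (le_max_right _ _) hv)))
    (mem_ball_zero_iff.2 (lt1 hzr)) hζ
  simp only [Function.comp_apply, ballMoebius_neg_self (lt1 hzr), ballMoebius_zero_right] at h
  rw [← norm_sq_combination hlm, ← hz] at h
  simp only [smul_eq_mul]
  nlinarith

end Envelope

/-! ### Semiconcave functions that are subharmonic on complex lines -/

/-- A continuous concave function on an open set has a supergradient at every point. -/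
theorem ConcaveOn.exists_supergradient {E : Type*} [NormedAddCommGroup E] [NormedSpace ℝ E]
    {s : Set E} {f : E → ℝ} (hf : ConcaveOn ℝ s f) (hs : IsOpen s) (hc : ContinuousOn f s)
    {x : E} (hx : x ∈ s) :
    ∃ q : E →L[ℝ] ℝ, ∀ y ∈ s, f y ≤ f x + q (y - x) := by
  set H : Set (E × ℝ) := {p | p.1 ∈ s ∧ p.2 < f p.1} with hH
  have hHo : IsOpen H := by
    have h1 : ContinuousOn (fun p : E × ℝ => f p.1 - p.2) (s ×ˢ univ) :=
      (hc.comp continuousOn_fst fun p hp => hp.1).sub continuousOn_snd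
    have h2 := h1.isOpen_inter_preimage (hs.prod isOpen_univ) (isOpen_Ioi (a := (0 : ℝ)))
    convert h2 using 1
    ext p
    simp [hH]
  obtain ⟨F, hF⟩ := geometric_hahn_banach_open_point hf.convex_strict_hypograph hHo
    (x := (x, f x)) (fun h => lt_irrefl _ h.2)
  set g : E →L[ℝ] ℝ := F.comp (ContinuousLinearMap.inl ℝ E ℝ) with hg
  set c : ℝ := F (0, 1) with hc'
  have hFd : ∀ y t, F (y, t) = g y + t * c := by
    intro y t
    have : ((y, t) : E × ℝ) = (y, 0) + t • ((0, 1) : E × ℝ) := by simp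
    rw [this, map_add, map_smul, smul_eq_mul]
    rfl
  have hcpos : 0 < c := by
    have := hF (x, f x - 1) ⟨hx, sub_one_lt _⟩
    rw [hFd, hFd] at this
    linarith
  refine ⟨-(c⁻¹ • g), fun y hy => ?_⟩
  have hle : g y + f y * c ≤ g x + f x * c := by
    refine le_of_forall_pos_le_add fun ε hε => ?_
    have := hF (y, f y - ε / c) ⟨hy, sub_lt_self _ (by positivity)⟩
    rw [hFd, hFd, sub_mul, div_mul_cancel₀ _ hcpos.ne'] at this
    linarith
  simp only [neg_apply, smul_apply, smul_eq_mul, map_sub]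
  have : f y ≤ f x + (g x - g y) / c := by
    rw [← sub_le_iff_le_add', le_div_iff₀ hcpos]; linarith
  calc f y ≤ _ := this
    _ = _ := by field_simp; ring

theorem ContinuousLinearMap.opNorm_le_div_of_norm_eq {E F : Type*} [NormedAddCommGroup E]
    [NormedSpace ℝ E] [NormedAddCommGroup F] [NormedSpace ℝ F] (l : E →L[ℝ] F) {t A : ℝ}
    (ht : 0 < t) (hA : 0 ≤ A) (h : ∀ v, ‖v‖ = t → ‖l v‖ ≤ A) : ‖l‖ ≤ A / t := by
  refine l.opNorm_le_bound (by positivity) fun v => ?_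
  rcases eq_or_ne v 0 with rfl | hv
  · simp
  have hv' : 0 < ‖v‖ := norm_pos_iff.2 hv
  have h1 := h ((t / ‖v‖) • v) (by
    rw [norm_smul, Real.norm_of_nonneg (by positivity), div_mul_cancel₀ _ hv'.ne'])
  rw [map_smul, norm_smul, Real.norm_of_nonneg (by positivity)] at h1
  rw [div_mul_eq_mul_div, le_div_iff₀ ht]
  rw [div_mul_eq_mul_div, div_le_iff₀ hv'] at h1
  linarith

section Regularity

variable {E : Type*} [NormedAddCommGroup E] [InnerProductSpace ℂ E]
  [NormedSpace ℝ E] [IsScalarTower ℝ ℂ E]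

/-- A nonnegative convex function at `v` is bounded by half the sum of its values at the four points
`±2wv`, `±2iwv` of a larger circle, where `‖w‖ = 1`: these are the vertices of a square that
contains `v`. -/
theorem ConvexOn.le_half_sum_of_norm_eq_one {s : Set E} {g : E → ℝ} (hg : ConvexOn ℝ s g)
    {v : E} (hs : ∀ w : ℂ, ‖w‖ = 1 → w • (2 : ℂ) • v ∈ s)
    (h0 : ∀ u ∈ s, 0 ≤ g u) {w : ℂ} (hw : ‖w‖ = 1) :
    g v ≤ (1 / 2) * (g (w • (2 : ℂ) • v) + g (w • (-2 : ℂ) • v) +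
      g (w • (2 * Complex.I) • v) + g (w • (-2 * Complex.I) • v)) := by
  have hrs : ∀ (a : ℝ) (x : E), a • x = (a : ℂ) • x := fun a x => RCLike.real_smul_eq_coe_smul a x
  have hw2 : w.re * w.re + w.im * w.im = 1 := by
    rw [← Complex.normSq_apply, Complex.normSq_eq_norm_sq, hw, one_pow]
  have hre : |w.re| ≤ 1 := hw ▸ Complex.abs_re_le_norm w
  have him : |w.im| ≤ 1 := hw ▸ Complex.abs_im_le_norm w
  have hmem : ∀ c : ℂ, ‖c‖ = 1 → w • (c * 2) • v ∈ s := by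
    intro c hc
    have := hs (w * c) (by rw [norm_mul, hw, hc, one_mul])
    rwa [mul_smul, smul_smul c] at this
  have m1 : w • (2 : ℂ) • v ∈ s := by simpa using hmem 1 (by simp)
  have m2 : w • (-2 : ℂ) • v ∈ s := by simpa using hmem (-1) (by simp)
  have m3 : w • (2 * Complex.I) • v ∈ s := by
    have := hmem Complex.I (by simp); rwa [mul_comm] at this
  have m4 : w • (-2 * Complex.I) • v ∈ s := by
    have := hmem (-Complex.I) (by simp)
    rwa [show -Complex.I * 2 = -2 * Complex.I by ring] at this
  -- on the diagonal with end points `x` and `-x`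
  have diag : ∀ x y : E, x ∈ s → y ∈ s → y = -x → ∀ t : ℝ, |t| ≤ 1 →
      t • x ∈ s ∧ g (t • x) ≤ g x + g y := by
    intro x y hx hy hyx t ht
    have ht' := abs_le.1 ht
    have e : t • x = ((1 + t) / 2) • x + ((1 - t) / 2) • y := by
      rw [hyx]; module
    have a0 : 0 ≤ (1 + t) / 2 := by linarith
    have b0 : 0 ≤ (1 - t) / 2 := by linarith
    have ab : (1 + t) / 2 + (1 - t) / 2 = 1 := by ring
    rw [e]
    refine ⟨hg.1 hx hy a0 b0 ab, (hg.2 hx hy a0 b0 ab).trans ?_⟩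
    rw [smul_eq_mul, smul_eq_mul]
    have := h0 x hx
    have := h0 y hy
    nlinarith
  obtain ⟨d1, d1'⟩ := diag _ _ m1 m2 (by simp only [neg_smul, smul_neg]) w.re hre
  obtain ⟨d2, d2'⟩ := diag _ _ m4 m3 (by simp only [neg_mul, neg_smul, smul_neg, neg_neg])
    w.im him
  have hv : v = (1 / 2 : ℝ) • (w.re • w • (2 : ℂ) • v) +
      (1 / 2 : ℝ) • (w.im • w • (-2 * Complex.I) • v) := by
    simp only [hrs, smul_smul, ← add_smul]
    have : ((1 / 2 : ℝ) : ℂ) * ((w.re : ℂ) * (w * 2)) +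
        ((1 / 2 : ℝ) : ℂ) * ((w.im : ℂ) * (w * (-2 * Complex.I))) = 1 := by
      apply Complex.ext
      · simp; linarith
      · simp; ring
    rw [show (((1 / 2 : ℝ) : ℂ) * ((w.re : ℂ) * (w * 2)) +
      ((1 / 2 : ℝ) : ℂ) * ((w.im : ℂ) * (w * (-2 * Complex.I)))) = 1 from this, one_smul]
  have hfin := hg.2 d1 d2 (by norm_num : (0 : ℝ) ≤ 1 / 2) (by norm_num : (0 : ℝ) ≤ 1 / 2)
    (by norm_num)
  rw [← hv, smul_eq_mul, smul_eq_mul] at hfin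
  linarith

/-- A semiconcave function that is subharmonic on complex lines has a first order Taylor expansion
with quadratic error. If `q` is a supergradient of `f - C‖·‖²` at `z`, the defect of the
corresponding inequality is a nonnegative convex function whose mean over circles is quadratically
small, and a nonnegative convex function is controlled by its circular means. -/
theorem exists_taylor_of_concaveOn_of_le_circleAverage [FiniteDimensional ℂ E] {f : E → ℝ}
    {R C : ℝ} (hC : 0 ≤ C) (hconc : ConcaveOn ℝ (ball (0 : E) R) fun z => f z - C * ‖z‖ ^ 2)
    (hsub : ∀ a b : E, (∀ w : ℂ, ‖w‖ ≤ 1 → a + w • b ∈ ball (0 : E) R) →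
      f a ≤ Real.circleAverage (fun w : ℂ => f (a + w • b)) 0 1)
    {z : E} (hz : z ∈ ball (0 : E) R) :
    ∃ l : E →L[ℝ] ℝ, ∀ v, ‖z‖ + 2 * ‖v‖ < R →
      |f (z + v) - f z - l v| ≤ 8 * C * ‖v‖ ^ 2 := by
  have : CompleteSpace E := FiniteDimensional.complete ℂ E
  have : FiniteDimensional ℝ E := Module.Finite.trans ℂ E
  have hFc := hconc.continuousOn isOpen_ball
  have hfc : ContinuousOn f (ball (0 : E) R) := by
    have h1 : ContinuousOn (fun z : E => C * ‖z‖ ^ 2) (ball (0 : E) R) := by fun_prop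
    refine (hFc.add h1).congr fun x _ => ?_
    simp
  obtain ⟨q, hq⟩ := hconc.exists_supergradient isOpen_ball hFc hz
  -- add the derivative at `z` of the quadratic function that was subtracted
  set l : E →L[ℝ] ℝ := q + (2 * C) • Complex.reCLM.comp ((innerSL ℂ z).restrictScalars ℝ) with hl
  have hlv : ∀ v, l v = q v + 2 * C * (inner ℂ z v : ℂ).re := fun v => by simp [hl]
  have hnsq : ∀ v : E, ‖z + v‖ ^ 2 = ‖z‖ ^ 2 + 2 * (inner ℂ z v : ℂ).re + ‖v‖ ^ 2 :=
    fun v => norm_add_sq (𝕜 := ℂ) z v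
  -- the defect of the supergradient inequality
  set g : E → ℝ := fun v => f z - C * ‖z‖ ^ 2 + q v - (f (z + v) - C * ‖z + v‖ ^ 2) with hg
  have hg' : ∀ v, g v = f z + l v + C * ‖v‖ ^ 2 - f (z + v) := fun v => by
    simp only [hg, hlv, hnsq]; ring
  set s : Set E := (fun v => z + v) ⁻¹' ball (0 : E) R with hs
  have hgconv : ConvexOn ℝ s g := by
    have h1 : ConcaveOn ℝ s fun v => f (z + v) - C * ‖z + v‖ ^ 2 := hconc.translate_right z
    have h2 : ConvexOn ℝ s fun v => f z - C * ‖z‖ ^ 2 + q v :=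
      (convexOn_const _ h1.1).add (q.toLinearMap.convexOn h1.1)
    exact h2.sub h1
  have hg0 : ∀ v ∈ s, 0 ≤ g v := by
    intro v hv
    have := hq (z + v) hv
    rw [add_sub_cancel_left] at this
    simp only [hg]; linarith
  refine ⟨l, fun v hv => ?_⟩
  have hin : ∀ b : E, ‖b‖ = 2 * ‖v‖ → ∀ w : ℂ, ‖w‖ ≤ 1 → z + w • b ∈ ball (0 : E) R := by
    intro b hb w hw
    rw [mem_ball_zero_iff]
    have h1 : ‖w • b‖ ≤ ‖b‖ := by
      rw [norm_smul]; exact mul_le_of_le_one_left (norm_nonneg _) hw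
    linarith [norm_add_le z (w • b)]
  have hcf : ∀ b : E, ‖b‖ = 2 * ‖v‖ → CircleIntegrable (fun w : ℂ => f (z + w • b)) 0 1 := by
    intro b hb
    refine ContinuousOn.circleIntegrable zero_le_one ?_
    refine hfc.comp (f := fun w : ℂ => z + w • b) (by fun_prop) fun w hw => hin b hb w ?_
    exact (mem_sphere_zero_iff_norm.1 hw).le
  have hcg0 : ∀ b : E, CircleIntegrable (fun w : ℂ => f z + l (w • b) + C * ‖w • b‖ ^ 2) 0 1 :=
    fun b => ContinuousOn.circleIntegrable' (Continuous.continuousOn (by fun_prop))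
  have hcg : ∀ b : E, ‖b‖ = 2 * ‖v‖ → CircleIntegrable (fun w : ℂ => g (w • b)) 0 1 := by
    intro b hb
    simp only [hg']
    exact (hcg0 b).sub (hcf b hb)
  have havg : ∀ b : E, ‖b‖ = 2 * ‖v‖ →
      Real.circleAverage (fun w : ℂ => g (w • b)) 0 1 ≤ 4 * C * ‖v‖ ^ 2 := by
    intro b hb
    simp only [hg']
    rw [Real.circleAverage_fun_sub (hcg0 b) (hcf b hb)]
    have i2 : CircleIntegrable (fun w : ℂ => l (w • b)) 0 1 :=
      ContinuousOn.circleIntegrable' (Continuous.continuousOn (by fun_prop))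
    have hlin : Real.circleAverage (fun w : ℂ => l (w • b)) 0 1 = 0 := by
      -- `w ↦ l (w • b)` is the real part of a complex linear function
      have hre : ∀ w : ℂ,
          l (w • b) = (w * ((l b : ℝ) - (l (Complex.I • b) : ℝ) * Complex.I)).re := by
        intro w
        have e : w • b = w.re • b + w.im • Complex.I • b := by
          rw [RCLike.real_smul_eq_coe_smul (K := ℂ) w.re,
            RCLike.real_smul_eq_coe_smul (K := ℂ) w.im, smul_smul, ← add_smul]
          congr 1
          exact (Complex.re_add_im w).symm
        rw [e, map_add, map_smul, map_smul]
        simp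
      rw [funext hre, circleAverage_re_of_differentiable (by fun_prop)]
      simp
    have hcongr : Real.circleAverage (fun w : ℂ => f z + l (w • b) + C * ‖w • b‖ ^ 2) 0 1 =
        Real.circleAverage (fun w : ℂ => l (w • b) + (f z + C * ‖b‖ ^ 2)) 0 1 := by
      refine Real.circleAverage_congr_sphere fun w hw => ?_
      have hw1 : ‖w‖ = 1 := by simpa using hw
      simp only [norm_smul, hw1, one_mul]; ring
    rw [hcongr, Real.circleAverage_fun_add i2 (circleIntegrable_const _ _ _), hlin,
      Real.circleAverage_const, hb]
    have := hsub z b (hin b hb)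
    linarith
  have hvR : z + v ∈ ball (0 : E) R := by
    rw [mem_ball_zero_iff]
    linarith [norm_add_le z v, norm_nonneg v]
  have hn : ∀ c : ℂ, ‖c‖ = 2 → ‖c • v‖ = 2 * ‖v‖ := fun c hc => by rw [norm_smul, hc]
  have n1 : ‖(2 : ℂ) • v‖ = 2 * ‖v‖ := hn _ (by simp)
  have n2 : ‖(-2 : ℂ) • v‖ = 2 * ‖v‖ := hn _ (by simp)
  have n3 : ‖(2 * Complex.I) • v‖ = 2 * ‖v‖ := hn _ (by simp)
  have n4 : ‖(-2 * Complex.I) • v‖ = 2 * ‖v‖ := hn _ (by simp)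
  -- half the sum of four circular means, each of which is at most `4 * C * ‖v‖ ^ 2`
  have hgv : g v ≤ 8 * C * ‖v‖ ^ 2 := by
    have j1 := hcg _ n1
    have j2 := hcg _ n2
    have j3 := hcg _ n3
    have j4 := hcg _ n4
    have i12 : CircleIntegrable (fun w : ℂ => g (w • (2 : ℂ) • v) + g (w • (-2 : ℂ) • v)) 0 1 :=
      j1.add j2
    have i123 : CircleIntegrable (fun w : ℂ => g (w • (2 : ℂ) • v) + g (w • (-2 : ℂ) • v) +
      g (w • (2 * Complex.I) • v)) 0 1 := i12.add j3
    have i1234 : CircleIntegrable (fun w : ℂ => g (w • (2 : ℂ) • v) + g (w • (-2 : ℂ) • v) +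
      g (w • (2 * Complex.I) • v) + g (w • (-2 * Complex.I) • v)) 0 1 := i123.add j4
    have hmono := Real.circleAverage_mono (circleIntegrable_const (2 * g v) 0 1) i1234 (by
      intro w hw
      have hw1 : ‖w‖ = 1 := by simpa using hw
      have := hgconv.le_half_sum_of_norm_eq_one (v := v)
        (fun w hw => hin _ n1 w hw.le) hg0 hw1
      linarith)
    rw [Real.circleAverage_const, Real.circleAverage_fun_add i123 j4,
      Real.circleAverage_fun_add i12 j3, Real.circleAverage_fun_add j1 j2] at hmono
    linarith [havg _ n1, havg _ n2, havg _ n3, havg _ n4]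
  have h0 := hg0 v hvR
  rw [hg'] at hgv h0
  have hCv : 0 ≤ C * ‖v‖ ^ 2 := by positivity
  rw [abs_le]
  constructor <;> linarith

/-- Interior `C^{1,1}` estimate for bounded semiconcave functions that are subharmonic on complex
lines; the constant depends only on the bound, the semiconcavity constant and the radii. -/
theorem exists_lipschitzOnWith_fderiv [FiniteDimensional ℂ E] {R r C M : ℝ} (hC : 0 ≤ C)
    (hM : 0 ≤ M) (hrR : r < R) :
    ∃ K : ℝ≥0, ∀ f : E → ℝ, (∀ z ∈ ball (0 : E) R, |f z| ≤ M) →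
      ConcaveOn ℝ (ball (0 : E) R) (fun z => f z - C * ‖z‖ ^ 2) →
      (∀ a b : E, (∀ w : ℂ, ‖w‖ ≤ 1 → a + w • b ∈ ball (0 : E) R) →
        f a ≤ Real.circleAverage (fun w : ℂ => f (a + w • b)) 0 1) →
      (∀ z ∈ ball (0 : E) R, DifferentiableAt ℝ f z) ∧
      (∀ z ∈ closedBall (0 : E) r, ‖fderiv ℝ f z‖ ≤ K) ∧
      LipschitzOnWith K (fderiv ℝ f) (closedBall (0 : E) r) := by
  set d : ℝ := R - r with hd
  have hd0 : 0 < d := sub_pos.2 hrR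
  -- `K₁` bounds the derivative, by the Taylor expansion with increments of length `d / 4`; the
  -- difference of derivatives at distance `h` is at most `48 * C * h` if `h < d / 8`, and for the
  -- larger distances the bound `2 * K₁` suffices
  set K₁ : ℝ := (2 * M + 8 * C * (d / 4) ^ 2) / (d / 4) with hK₁
  have hK₁0 : 0 ≤ K₁ := by positivity
  set K : ℝ := max K₁ (max (16 * K₁ / d) (48 * C)) with hK
  have hK0 : 0 ≤ K := le_max_of_le_left hK₁0
  refine ⟨⟨K, hK0⟩, fun f hfM hconc hsub => ?_⟩
  have htay : ∀ z ∈ ball (0 : E) R, DifferentiableAt ℝ f z ∧ ∀ v, ‖z‖ + 2 * ‖v‖ < R →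
      |f (z + v) - f z - fderiv ℝ f z v| ≤ 8 * C * ‖v‖ ^ 2 := by
    intro z hz
    obtain ⟨l, hl⟩ := exists_taylor_of_concaveOn_of_le_circleAverage hC hconc hsub hz
    have hder : HasFDerivAt f l z := by
      rw [hasFDerivAt_iff_isLittleO_nhds_zero]
      have hzR : ‖z‖ < R := mem_ball_zero_iff.1 hz
      have hO : (fun v => f (z + v) - f z - l v) =O[𝓝 0] fun v : E => ‖v‖ ^ 2 := by
        refine Asymptotics.IsBigO.of_bound (8 * C) ?_
        filter_upwards [ball_mem_nhds (0 : E) (show 0 < (R - ‖z‖) / 2 by linarith)] with v hv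
        rw [mem_ball_zero_iff] at hv
        rw [Real.norm_eq_abs, norm_pow, norm_norm]
        exact hl v (by linarith)
      refine hO.trans_isLittleO ?_
      exact Asymptotics.isLittleO_norm_pow_id one_lt_two
    refine ⟨hder.differentiableAt, fun v hv => ?_⟩
    rw [hder.fderiv]; exact hl v hv
  have hsubR : closedBall (0 : E) r ⊆ ball 0 R := closedBall_subset_ball hrR
  have hbd : ∀ z ∈ closedBall (0 : E) r, ‖fderiv ℝ f z‖ ≤ K₁ := by
    intro z hz
    have hzr : ‖z‖ ≤ r := mem_closedBall_zero_iff.1 hz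
    refine ContinuousLinearMap.opNorm_le_div_of_norm_eq _ (by positivity) (by positivity) ?_
    intro v hv
    have h1 := (htay z (hsubR hz)).2 v (by rw [hv]; linarith)
    have h2 := hfM z (hsubR hz)
    have h3 := hfM (z + v) (mem_ball_zero_iff.2 (by
      have := norm_add_le z v
      rw [hv] at this; linarith))
    rw [hv] at h1
    rw [Real.norm_eq_abs]
    rw [abs_le] at *
    constructor <;> linarith [h1.1, h1.2, h2.1, h2.2, h3.1, h3.2]
  refine ⟨fun z hz => (htay z hz).1, fun z hz => (hbd z hz).trans (le_max_left _ _), ?_⟩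
  refine LipschitzOnWith.of_dist_le_mul fun z hz w hw => ?_
  rw [dist_comm, dist_eq_norm, dist_comm z w, dist_eq_norm]
  change _ ≤ K * _
  set h := ‖w - z‖ with hh
  rcases (norm_nonneg (w - z)).eq_or_lt with h0 | h0
  · have : w = z := by rw [← sub_eq_zero, ← norm_eq_zero]; exact h0.symm
    rw [this]; simp only [sub_self, norm_zero]; positivity
  rcases le_or_gt (d / 8) h with hdh | hdh
  · calc ‖fderiv ℝ f w - fderiv ℝ f z‖ ≤ K₁ + K₁ :=
          (norm_sub_le _ _).trans (add_le_add (hbd w hw) (hbd z hz))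
      _ = 16 * K₁ / d * (d / 8) := by field_simp; ring
      _ ≤ 16 * K₁ / d * h := by gcongr
      _ ≤ K * h := by
        gcongr
        exact (le_max_left _ _).trans (le_max_right _ _)
  · have hzr : ‖z‖ ≤ r := mem_closedBall_zero_iff.1 hz
    have hwr : ‖w‖ ≤ r := mem_closedBall_zero_iff.1 hw
    -- compare the expansions at `z` and at `w` of the value at `w + u`, where `‖u‖ = h`
    have hmain : ‖fderiv ℝ f w - fderiv ℝ f z‖ ≤ 48 * C * h ^ 2 / h := by
      refine ContinuousLinearMap.opNorm_le_div_of_norm_eq _ h0 (by positivity) fun u hu => ?_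
      have hwu : ‖w - z + u‖ ≤ 2 * h := by
        have := norm_add_le (w - z) u
        rw [hu] at this; linarith
      have t1 := (htay z (hsubR hz)).2 (w - z) (by linarith)
      have t2 := (htay z (hsubR hz)).2 (w - z + u) (by linarith)
      have t3 := (htay w (hsubR hw)).2 u (by rw [hu]; linarith)
      rw [add_sub_cancel] at t1
      rw [← add_assoc, add_sub_cancel, map_add] at t2
      have hsq : ‖w - z + u‖ ^ 2 ≤ 4 * h ^ 2 := by
        nlinarith [norm_nonneg (w - z + u)]
      have t2' : 8 * C * ‖w - z + u‖ ^ 2 ≤ 8 * C * (4 * h ^ 2) := by gcongr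
      rw [hu] at t3
      have t2'' := t2.trans t2'
      rw [sub_apply, Real.norm_eq_abs]
      rw [abs_le] at t1 t2'' t3 ⊢
      constructor <;> linarith [t1.1, t1.2, t2''.1, t2''.2, t3.1, t3.2]
    calc _ ≤ _ := hmain
      _ = 48 * C * h := by field_simp
      _ ≤ K * h := by
        gcongr
        exact (le_max_right _ _).trans (le_max_right _ _)

end Regularity

/-! ### Regularity and measurability of the derivatives of the envelope -/

/-- The derivative with respect to `x` of a family `f a x` that is measurable in the parameter `a`
and equicontinuous in `x` is jointly measurable. Such a family is determined by countably many
measurable functions of `a`, which are all continuous for a finer Polish topology with the same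
Borel sets; the family is then jointly continuous. -/
theorem measurable_fderiv_of_equicontinuous {α E F : Type*} [MeasurableSpace α]
    [StandardBorelSpace α] [NormedAddCommGroup E] [NormedSpace ℝ E] [FiniteDimensional ℝ E]
    [MeasurableSpace E] [BorelSpace E] [NormedAddCommGroup F] [NormedSpace ℝ F] [CompleteSpace F]
    [SecondCountableTopology F] [MeasurableSpace F] [BorelSpace F] {f : α → E → F}
    (hm : ∀ x, Measurable fun a => f a x)
    (he : ∀ x, ∀ ε > 0, ∀ᶠ y in 𝓝 x, ∀ a, dist (f a y) (f a x) < ε) :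
    Measurable (fun p : α × E => fderiv ℝ (f p.1) p.2) ∧
      MeasurableSet {p : α × E | DifferentiableAt ℝ (f p.1) p.2} := by
  let _ := upgradeStandardBorel α
  have hpol₀ : PolishSpace α := inferInstance
  have hbor₀ : BorelSpace α := inferInstance
  have hφ : Measurable fun (a : α) (n : ℕ) => f a (TopologicalSpace.denseSeq E n) :=
    measurable_pi_lambda _ fun n => hm _
  obtain ⟨t', hle, hcont, hpol⟩ := hφ.exists_continuous
  have hborel : @OpensMeasurableSpace α t' _ := by
    refine @OpensMeasurableSpace.mk α t' _ ?_
    rw [borel_eq_borel_of_le hpol hpol₀ hle]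
    exact hbor₀.measurable_eq.ge
  have hjoint : @Continuous (α × E) F (@instTopologicalSpaceProd α E t' _) _
      (Function.uncurry f) := by
    let _ := t'
    rw [continuous_iff_continuousAt]
    rintro ⟨a₀, x₀⟩
    rw [Metric.continuousAt_iff']
    intro ε hε
    have hε4 : 0 < ε / 4 := by positivity
    have h1 := he x₀ _ hε4
    obtain ⟨U, hU, hUo, hxU⟩ := _root_.eventually_nhds_iff.1 h1
    obtain ⟨n, hn⟩ := (TopologicalSpace.denseRange_denseSeq E).exists_mem_open hUo ⟨x₀, hxU⟩
    have h2 : ∀ᶠ a in 𝓝 a₀, dist (f a (TopologicalSpace.denseSeq E n))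
        (f a₀ (TopologicalSpace.denseSeq E n)) < ε / 4 := by
      have hc : Continuous fun a => f a (TopologicalSpace.denseSeq E n) :=
        (continuous_apply n).comp hcont
      exact Metric.continuousAt_iff'.1 hc.continuousAt _ hε4
    filter_upwards [h2.prod_nhds h1] with p hp
    have d1 := hp.2 p.1
    have d2 := hU _ hn p.1
    have d3 := hU _ hn a₀
    rw [dist_comm] at d2
    have d4 := dist_triangle4 (f p.1 p.2) (f p.1 x₀) (f p.1 (TopologicalSpace.denseSeq E n))
      (f a₀ (TopologicalSpace.denseSeq E n))
    have d5 := dist_triangle (f p.1 p.2) (f a₀ (TopologicalSpace.denseSeq E n)) (f a₀ x₀)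
    simp only [Function.uncurry]
    linarith [hp.1]
  have : LocallyCompactSpace E := inferInstance
  exact ⟨@measurable_fderiv_with_param ℝ _ E _ _ _ F _ _ α t' f _ hborel _ _ _ hjoint,
    @measurableSet_of_differentiableAt_with_param ℝ _ E _ _ _ F _ _ α t' f _ hborel _ _ _ hjoint⟩

/-- The radial retraction onto the closed ball of radius `r` centred at the origin, for `r > 0`. -/
noncomputable def radialRetraction {E : Type*} [NormedAddCommGroup E] [NormedSpace ℝ E] (r : ℝ)
    (z : E) : E :=
  (r / max r ‖z‖) • z

section RadialRetraction

variable {E : Type*} [NormedAddCommGroup E] [NormedSpace ℝ E] {r : ℝ}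

theorem continuous_radialRetraction (hr : 0 < r) :
    Continuous (radialRetraction r : E → E) := by
  unfold radialRetraction
  refine Continuous.smul (continuous_const.div (by fun_prop) fun z => ?_) continuous_id
  exact (lt_max_of_lt_left hr).ne'

theorem radialRetraction_mem (hr : 0 < r) (z : E) :
    radialRetraction r z ∈ closedBall (0 : E) r := by
  have hm : 0 < max r ‖z‖ := lt_max_of_lt_left hr
  rw [mem_closedBall_zero_iff, radialRetraction, norm_smul, Real.norm_of_nonneg (by positivity),
    div_mul_eq_mul_div, div_le_iff₀ hm]
  exact mul_le_mul_of_nonneg_left (le_max_right _ _) hr.le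

theorem radialRetraction_of_mem (hr : 0 < r) {z : E} (hz : z ∈ closedBall (0 : E) r) :
    radialRetraction r z = z := by
  rw [radialRetraction, max_eq_left (mem_closedBall_zero_iff.1 hz), div_self hr.ne', one_smul]

theorem radialRetraction_eventuallyEq (hr : 0 < r) {z : E} (hz : z ∈ ball (0 : E) r) :
    (radialRetraction r : E → E) =ᶠ[𝓝 z] id := by
  filter_upwards [isOpen_ball.mem_nhds hz] with y hy
  exact radialRetraction_of_mem hr (ball_subset_closedBall hy)

/-- A uniformly Lipschitz family on a closed ball becomes equicontinuous on the whole space after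
composition with the retraction. -/
theorem eventually_dist_indicator_radialRetraction_lt {α F : Type*} [NormedAddCommGroup F]
    {A : Set α} {K : ℝ≥0} (hr : 0 < r) {g : α → E → F}
    (hg : ∀ a ∈ A, LipschitzOnWith K (g a) (closedBall (0 : E) r)) (x : E) (ε : ℝ) (hε : ε > 0) :
    ∀ᶠ y in 𝓝 x, ∀ a, dist (A.indicator (fun a => g a (radialRetraction r y)) a)
      (A.indicator (fun a => g a (radialRetraction r x)) a) < ε := by
  have hc : Continuous fun y => (K : ℝ) * dist (radialRetraction r y) (radialRetraction r x) :=
    continuous_const.mul ((continuous_radialRetraction hr).dist continuous_const)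
  have h0 := hc.tendsto x
  simp only [dist_self, mul_zero] at h0
  filter_upwards [h0.eventually (gt_mem_nhds hε)] with y hy a
  by_cases ha : a ∈ A
  · rw [indicator_of_mem ha, indicator_of_mem ha]
    exact ((hg a ha).dist_le_mul _ (radialRetraction_mem hr y) _
      (radialRetraction_mem hr x)).trans_lt hy
  · rw [indicator_of_notMem ha, indicator_of_notMem ha, dist_self]
    exact hε

end RadialRetraction

section Envelope

variable {E : Type*} [NormedAddCommGroup E] [InnerProductSpace ℂ E]
  [NormedSpace ℝ E] [IsScalarTower ℝ ℂ E] [FiniteDimensional ℂ E] {φ₀ φ₁ : E → ℝ}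

/-- Interior `C^{1,1}` regularity of the envelope in `z`, uniformly in `ζ`. -/
theorem exists_lipschitzOnWith_zDeriv
    (h₀ : IsC11On φ₀ (ball (0 : E) 1)) (h₁ : IsC11On φ₁ (ball (0 : E) 1)) {r : ℝ}
    (hr : r < 1) :
    ∃ K : ℝ≥0, ∀ ζ ∈ annulus,
      (∀ z ∈ closedBall (0 : E) r,
        DifferentiableAt ℝ (fun x => perronEnvelope (ball (0 : E) 1) φ₀ φ₁ (x, ζ)) z) ∧
      (∀ z ∈ closedBall (0 : E) r,
        ‖zDeriv (perronEnvelope (ball (0 : E) 1) φ₀ φ₁) ζ z‖ ≤ K) ∧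
      LipschitzOnWith K (zDeriv (perronEnvelope (ball (0 : E) 1) φ₀ φ₁) ζ)
        (closedBall (0 : E) r) := by
  have : ProperSpace E := FiniteDimensional.proper ℂ E
  have : FiniteDimensional ℝ E := Module.Finite.trans ℂ E
  obtain ⟨R, hrR, hR⟩ := exists_between hr
  obtain ⟨M₀, hM₀⟩ := h₀.exists_abs_le
  obtain ⟨M₁, hM₁⟩ := h₁.exists_abs_le
  set M := max M₀ M₁
  have hM₀' : ∀ z ∈ closedBall (0 : E) 1, |φ₀ z| ≤ M := fun z hz =>
    (hM₀ z hz).trans (le_max_left _ _)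
  have hM₁' : ∀ z ∈ closedBall (0 : E) 1, |φ₁ z| ≤ M := fun z hz =>
    (hM₁ z hz).trans (le_max_right _ _)
  have hM : 0 ≤ M := (abs_nonneg _).trans (hM₀' 0 (by simp))
  obtain ⟨C, hC, hconc⟩ := exists_concaveOn_perronEnvelope h₀ h₁ hR
  obtain ⟨K, hK⟩ := exists_lipschitzOnWith_fderiv (E := E) hC hM hrR
  refine ⟨K, fun ζ hζ => ?_⟩
  have hRsub : ball (0 : E) R ⊆ ball 0 1 := ball_subset_ball hR.le
  -- semiconcavity on every smaller ball gives continuity on the whole unit ball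
  have hcont : ContinuousOn (fun z => perronEnvelope (ball (0 : E) 1) φ₀ φ₁ (z, ζ))
      (ball 0 1) := by
    intro z hz
    obtain ⟨s, hzs, hs⟩ := exists_between (mem_ball_zero_iff.1 hz)
    obtain ⟨C', -, hconc'⟩ := exists_concaveOn_perronEnvelope h₀ h₁ hs
    have hF := ((hconc' ζ hζ).subset ball_subset_closedBall (convex_ball _ _)).continuousOn
      isOpen_ball
    have h1 : ContinuousOn (fun z : E => C' * ‖z‖ ^ 2) (ball (0 : E) s) := by fun_prop
    have h2 : ContinuousOn (fun z => perronEnvelope (ball (0 : E) 1) φ₀ φ₁ (z, ζ))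
        (ball (0 : E) s) := (hF.add h1).congr fun x _ => by simp
    exact (h2.continuousAt (isOpen_ball.mem_nhds (mem_ball_zero_iff.2 hzs))).continuousWithinAt
  obtain ⟨k1, k2, k3⟩ := hK (fun z => perronEnvelope (ball (0 : E) 1) φ₀ φ₁ (z, ζ))
    (fun z hz => abs_perronEnvelope_le hM₀' hM₁' ⟨hRsub hz, hζ⟩)
    ((hconc ζ hζ).subset ball_subset_closedBall (convex_ball _ _))
    (fun a b hab => perronEnvelope_le_circleAverage hM₀' hM₁' hζ hcont a b
      fun w hw => hRsub (hab w hw))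
  exact ⟨fun z hz => k1 z (closedBall_subset_ball hrR hz), k2, k3⟩

variable [MeasurableSpace E] [BorelSpace E]

/-- On `ball × annulus` the second derivative in `z` agrees with a jointly measurable map, and its
domain of existence with a measurable set. -/
theorem exists_measurable_zDeriv2
    (h₀ : IsC11On φ₀ (ball (0 : E) 1)) (h₁ : IsC11On φ₁ (ball (0 : E) 1)) {r : ℝ} (hr0 : 0 < r)
    (hr : r < 1) :
    ∃ (D : ℂ × E → E →L[ℝ] E →L[ℝ] ℝ) (S : Set (ℂ × E)), Measurable D ∧ MeasurableSet S ∧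
      ∀ ζ ∈ annulus, ∀ z ∈ ball (0 : E) r,
        D (ζ, z) = zDeriv2 (perronEnvelope (ball (0 : E) 1) φ₀ φ₁) ζ z ∧
        ((ζ, z) ∈ S ↔
          DifferentiableAt ℝ (zDeriv (perronEnvelope (ball (0 : E) 1) φ₀ φ₁) ζ) z) := by
  have : ProperSpace E := FiniteDimensional.proper ℂ E
  have : FiniteDimensional ℝ E := Module.Finite.trans ℂ E
  obtain ⟨M₀, hM₀⟩ := h₀.exists_abs_le
  obtain ⟨M₁, hM₁⟩ := h₁.exists_abs_le
  set Φ := perronEnvelope (ball (0 : E) 1) φ₀ φ₁ with hΦ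
  obtain ⟨R, hrR, hR⟩ := exists_between hr
  have hR0 : 0 < R := hr0.trans hrR
  obtain ⟨K, hK⟩ := exists_lipschitzOnWith_zDeriv h₀ h₁ hR
  have hLip0 : ∀ ζ ∈ annulus, LipschitzOnWith K (fun z => Φ (z, ζ)) (closedBall (0 : E) R) :=
    fun ζ hζ => (convex_closedBall (0 : E) R).lipschitzOnWith_of_nnnorm_fderiv_le (𝕜 := ℝ)
      (hK ζ hζ).1 (hK ζ hζ).2.1
  have hLip1 : ∀ ζ ∈ annulus, LipschitzOnWith K (zDeriv Φ ζ) (closedBall (0 : E) r) :=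
    fun ζ hζ => (hK ζ hζ).2.2.mono (closedBall_subset_closedBall hrR.le)
  -- the first derivative: the zero extension off the annulus and the retraction onto a larger
  -- ball make the family equicontinuous without changing it on the smaller ball
  obtain ⟨hD1, -⟩ := measurable_fderiv_of_equicontinuous
    (f := fun (ζ : ℂ) (z : E) => annulus.indicator (fun ζ => Φ (radialRetraction R z, ζ)) ζ)
    (fun z => measurable_indicator_perronEnvelope
      (fun x hx => (hM₀ x hx).trans (le_max_left M₀ M₁))
      (fun x hx => (hM₁ x hx).trans (le_max_right M₀ M₁))
      (closedBall_subset_ball hR (radialRetraction_mem hR0 z)))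
    (eventually_dist_indicator_radialRetraction_lt hR0 hLip0)
  have hD1_eq : ∀ ζ ∈ annulus, ∀ z ∈ ball (0 : E) R,
      fderiv ℝ (fun z => annulus.indicator (fun ζ => Φ (radialRetraction R z, ζ)) ζ) z =
        zDeriv Φ ζ z := by
    intro ζ hζ z hz
    refine Filter.EventuallyEq.fderiv_eq ?_
    filter_upwards [radialRetraction_eventuallyEq hR0 hz] with y hy
    rw [indicator_of_mem hζ, hy, id]
  have hmeas1 : ∀ z : E, Measurable
      fun ζ => annulus.indicator (fun ζ => zDeriv Φ ζ (radialRetraction r z)) ζ := by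
    intro z
    have h1 : Measurable fun ζ : ℂ => fderiv ℝ
        (fun z => annulus.indicator (fun ζ => Φ (radialRetraction R z, ζ)) ζ)
        (radialRetraction r z) :=
      hD1.comp (measurable_id.prodMk measurable_const)
    convert h1.indicator isOpen_annulus.measurableSet using 1
    refine funext fun ζ => ?_
    by_cases hζ : ζ ∈ annulus
    · rw [indicator_of_mem hζ, indicator_of_mem hζ]
      exact (hD1_eq ζ hζ _ (closedBall_subset_ball hrR (radialRetraction_mem hr0 z))).symm
    · rw [indicator_of_notMem hζ, indicator_of_notMem hζ]
  -- the second derivative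
  obtain ⟨hD2, hS⟩ := measurable_fderiv_of_equicontinuous
    (f := fun (ζ : ℂ) (z : E) =>
      annulus.indicator (fun ζ => zDeriv Φ ζ (radialRetraction r z)) ζ) hmeas1
    (eventually_dist_indicator_radialRetraction_lt hr0 hLip1)
  refine ⟨_, _, hD2, hS, fun ζ hζ z hz => ?_⟩
  have hev : (fun z => annulus.indicator (fun ζ => zDeriv Φ ζ (radialRetraction r z)) ζ) =ᶠ[𝓝 z]
      zDeriv Φ ζ := by
    filter_upwards [radialRetraction_eventuallyEq hr0 hz] with y hy
    rw [indicator_of_mem hζ, hy, id]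
  exact ⟨hev.fderiv_eq, hev.differentiableAt_iff⟩

end Envelope

theorem eLpNorm_zDeriv2_le {E : Type*} [NormedAddCommGroup E] [NormedSpace ℝ E]
    [MeasurableSpace E] {Φ : E × ℂ → ℝ} (μ : Measure (E × ℂ)) {s : Set E}
    (hs : MeasurableSet s) {C : ℝ≥0} (h : ∀ ζ ∈ annulus, ∀ z ∈ s, ‖zDeriv2 Φ ζ z‖ ≤ C) :
    eLpNorm (fun p : E × ℂ => zDeriv2 Φ p.2 p.1) ∞ (μ.restrict (s ×ˢ annulus)) ≤ C := by
  have hae : ∀ᵐ p ∂(μ.restrict (s ×ˢ annulus)), ‖zDeriv2 Φ p.2 p.1‖₊ ≤ C := by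
    rw [ae_restrict_iff' (hs.prod isOpen_annulus.measurableSet)]
    exact Eventually.of_forall fun p hp => h p.2 hp.2 p.1 hp.1
  rw [eLpNorm_exponent_top]
  exact eLpNormEssSup_le_of_ae_nnnorm_bound (F := E →L[ℝ] E →L[ℝ] ℝ) (C := C) hae

section Envelope

variable {E : Type*} [NormedAddCommGroup E] [InnerProductSpace ℂ E]
  [NormedSpace ℝ E] [IsScalarTower ℝ ℂ E] [FiniteDimensional ℂ E] {φ₀ φ₁ : E → ℝ}
  [MeasurableSpace E] [BorelSpace E]

/-- Rademacher's theorem for the derivative of the envelope on a slice. -/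
theorem ae_differentiableAt_zDeriv
    (h₀ : IsC11On φ₀ (ball (0 : E) 1)) (h₁ : IsC11On φ₁ (ball (0 : E) 1)) (μ : Measure E)
    [μ.IsAddHaarMeasure] {r : ℝ} (hr : r < 1) {ζ : ℂ} (hζ : ζ ∈ annulus) :
    ∀ᵐ z ∂μ, z ∈ ball (0 : E) r →
      DifferentiableAt ℝ (zDeriv (perronEnvelope (ball (0 : E) 1) φ₀ φ₁) ζ) z := by
  have : FiniteDimensional ℝ E := Module.Finite.trans ℂ E
  obtain ⟨K, hK⟩ := exists_lipschitzOnWith_zDeriv h₀ h₁ hr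
  filter_upwards [((hK ζ hζ).2.2.mono ball_subset_closedBall).ae_differentiableWithinAt_of_mem
    (μ := μ)] with z hz hzr
  exact (hz hzr).differentiableAt (isOpen_ball.mem_nhds hzr)

/-- The slicewise statement and Fubini's theorem, which applies since the exceptional set is
measurable. -/
theorem ae_prod_differentiableAt_zDeriv
    (h₀ : IsC11On φ₀ (ball (0 : E) 1)) (h₁ : IsC11On φ₁ (ball (0 : E) 1)) (μ : Measure E)
    [μ.IsAddHaarMeasure] {r : ℝ} (hr0 : 0 < r) (hr : r < 1) :
    ∀ᵐ p ∂(μ.prod (volume : Measure ℂ)), p ∈ ball (0 : E) r ×ˢ annulus →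
      DifferentiableAt ℝ (zDeriv (perronEnvelope (ball (0 : E) 1) φ₀ φ₁) p.2) p.1 := by
  have : ProperSpace E := FiniteDimensional.proper ℂ E
  obtain ⟨D, S, -, hS, hDS⟩ := exists_measurable_zDeriv2 h₀ h₁ hr0 hr
  have hmeas : MeasurableSet ((ball (0 : E) r ×ˢ annulus) \ Prod.swap ⁻¹' S) :=
    (measurableSet_ball.prod isOpen_annulus.measurableSet).diff (measurable_swap hS)
  have hnull : (μ.prod (volume : Measure ℂ))
      ((ball (0 : E) r ×ˢ annulus) \ Prod.swap ⁻¹' S) = 0 := by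
    rw [Measure.prod_apply_symm hmeas]
    refine lintegral_eq_zero_of_ae_eq_zero (Eventually.of_forall fun ζ => ?_)
    by_cases hζ : ζ ∈ annulus
    · refine measure_mono_null ?_ (ae_differentiableAt_zDeriv h₀ h₁ μ hr hζ)
      intro z hz
      have hz1 : z ∈ ball (0 : E) r := hz.1.1
      simp only [mem_compl_iff, mem_ofPred_eq, Classical.not_imp]
      exact ⟨hz1, fun hd => hz.2 ((hDS ζ hζ z hz1).2.2 hd)⟩
    · have : (fun z : E => (z, ζ)) ⁻¹' ((ball (0 : E) r ×ˢ annulus) \ Prod.swap ⁻¹' S) = ∅ := by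
        ext z; simp [hζ]
      simp only [this, measure_empty, Pi.zero_apply]
  have hae := measure_eq_zero_iff_ae_notMem.1 hnull
  filter_upwards [hae] with p hp hpB
  by_contra hd
  exact hp ⟨hpB, fun hpS => hd ((hDS p.2 hpB.2 p.1 hpB.1).2.1 hpS)⟩

theorem aestronglyMeasurable_zDeriv2
    (h₀ : IsC11On φ₀ (ball (0 : E) 1)) (h₁ : IsC11On φ₁ (ball (0 : E) 1)) (μ : Measure E)
    {r : ℝ} (hr0 : 0 < r) (hr : r < 1) {s : Set E} (hs : MeasurableSet s) (hsr : s ⊆ ball 0 r) :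
    AEStronglyMeasurable
      (fun p : E × ℂ => zDeriv2 (perronEnvelope (ball (0 : E) 1) φ₀ φ₁) p.2 p.1)
      ((μ.prod (volume : Measure ℂ)).restrict (s ×ˢ annulus)) := by
  have : FiniteDimensional ℝ E := Module.Finite.trans ℂ E
  obtain ⟨D, S, hD, -, hDS⟩ := exists_measurable_zDeriv2 h₀ h₁ hr0 hr
  have hDm : Measurable fun p : E × ℂ => D p.swap := hD.comp measurable_swap
  refine AEStronglyMeasurable.congr hDm.aestronglyMeasurable ?_
  rw [Filter.EventuallyEq, ae_restrict_iff' (hs.prod isOpen_annulus.measurableSet)]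
  exact Eventually.of_forall fun p hp => (hDS p.2 hp.2 p.1 (hsr hp.1)).1

end Envelope

theorem theorem3p2 (n : ℕ) (hn : 1 ≤ n) (φ₀ φ₁ : EuclideanSpace ℂ (Fin n) → ℝ)
    (h₀ : IsC11On φ₀ (Metric.ball (0 : EuclideanSpace ℂ (Fin n)) 1))
    (h₁ : IsC11On φ₁ (Metric.ball (0 : EuclideanSpace ℂ (Fin n)) 1))
    (hb₀ : ∀ z ∈ Metric.sphere (0 : EuclideanSpace ℂ (Fin n)) 1, φ₀ z = 0)
    (hb₁ : ∀ z ∈ Metric.sphere (0 : EuclideanSpace ℂ (Fin n)) 1, φ₁ z = 0)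
    (B : Set (EuclideanSpace ℂ (Fin n))) (hB : B = Metric.ball 0 1)
    (Φ : EuclideanSpace ℂ (Fin n) × ℂ → ℝ) (hΦ : Φ = perronEnvelope B φ₀ φ₁) :
    -- the supremum defining the envelope is a genuine one
    (∀ p ∈ B ×ˢ annulus,
      IsLUB ((fun u : EuclideanSpace ℂ (Fin n) × ℂ → ℝ => u p) ''
        subsolutions B (boundaryData B φ₀ φ₁)) (Φ p)) ∧
    -- existence of the derivatives, for each `ζ` and almost every `z`
    (∀ ζ ∈ annulus,
      (∀ z ∈ B, DifferentiableAt ℝ (fun x => Φ (x, ζ)) z) ∧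
      ∀ᵐ z ∂(volume.restrict B), DifferentiableAt ℝ (zDeriv Φ ζ) z) ∧
    -- existence almost everywhere in the product
    (∀ᵐ p ∂(volume.restrict (B ×ˢ annulus)), DifferentiableAt ℝ (zDeriv Φ p.2) p.1) ∧
    -- bounds on compact sets, uniform in `ζ`
    ∀ K : Set (EuclideanSpace ℂ (Fin n)), IsCompact K → K ⊆ B →
      ∃ C : ℝ≥0,
        (∀ ζ ∈ annulus,
          LipschitzOnWith C (zDeriv Φ ζ) K ∧
          ∀ᵐ z ∂(volume.restrict K), ‖zDeriv2 Φ ζ z‖ ≤ C) ∧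
        AEStronglyMeasurable (fun p : EuclideanSpace ℂ (Fin n) × ℂ => zDeriv2 Φ p.2 p.1)
          (volume.restrict (K ×ˢ annulus)) ∧
        eLpNorm (fun p : EuclideanSpace ℂ (Fin n) × ℂ => zDeriv2 Φ p.2 p.1) ∞
          (volume.restrict (K ×ˢ annulus)) ≤ C := by
  subst hB hΦ
  obtain ⟨M₀, hM₀⟩ := h₀.exists_abs_le
  obtain ⟨M₁, hM₁⟩ := h₁.exists_abs_le
  -- the unit ball is exhausted by countably many smaller balls
  have hexh : ∀ z ∈ ball (0 : EuclideanSpace ℂ (Fin n)) 1, ∃ k : ℕ,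
      z ∈ ball (0 : EuclideanSpace ℂ (Fin n)) (1 - 1 / ((k : ℝ) + 2)) := by
    intro z hz
    rw [mem_ball_zero_iff] at hz
    obtain ⟨k, hk⟩ := exists_nat_one_div_lt (sub_pos.2 hz)
    refine ⟨k, mem_ball_zero_iff.2 ?_⟩
    have : 1 / ((k : ℝ) + 2) ≤ 1 / ((k : ℝ) + 1) :=
      one_div_le_one_div_of_le (by positivity) (by linarith)
    linarith
  have hlt : ∀ k : ℕ, 1 - 1 / ((k : ℝ) + 2) < 1 := fun k => by
    have : 0 < 1 / ((k : ℝ) + 2) := by positivity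
    linarith
  have hpos : ∀ k : ℕ, 0 < 1 - 1 / ((k : ℝ) + 2) := fun k => by
    have : 1 / ((k : ℝ) + 2) < 1 := by
      rw [div_lt_one (by positivity)]
      have : (0 : ℝ) ≤ k := k.cast_nonneg
      linarith
    linarith
  refine ⟨fun p hp => isLUB_perronEnvelope (fun x hx => (hM₀ x hx).trans (le_max_left M₀ M₁))
    (fun x hx => (hM₁ x hx).trans (le_max_right M₀ M₁)) hp, fun ζ hζ => ⟨fun z hz => ?_, ?_⟩,
    ?_, fun K hK hKB => ?_⟩
  · obtain ⟨k, hk⟩ := hexh z hz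
    obtain ⟨_, hC⟩ := exists_lipschitzOnWith_zDeriv h₀ h₁ (hlt k)
    exact (hC ζ hζ).1 z (ball_subset_closedBall hk)
  · rw [ae_restrict_iff' measurableSet_ball]
    filter_upwards [ae_all_iff.2 fun k : ℕ =>
      ae_differentiableAt_zDeriv h₀ h₁ volume (hlt k) hζ] with z hz hzB
    obtain ⟨k, hk⟩ := hexh z hzB
    exact hz k hk
  · rw [ae_restrict_iff' (measurableSet_ball.prod isOpen_annulus.measurableSet),
      Measure.volume_eq_prod]
    filter_upwards [ae_all_iff.2 fun k : ℕ =>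
      ae_prod_differentiableAt_zDeriv h₀ h₁ volume (hpos k) (hlt k)] with p hp hpB
    obtain ⟨k, hk⟩ := hexh p.1 hpB.1
    exact hp k ⟨hk, hpB.2⟩
  · obtain ⟨s, hs, hKs⟩ := exists_lt_subset_ball hK.isClosed hKB
    obtain ⟨r, hsr, hr⟩ := exists_between (max_lt hs one_pos)
    have hr0 : 0 < r := (le_max_right _ _).trans_lt hsr
    have hKr : K ⊆ ball 0 r := hKs.trans (ball_subset_ball ((le_max_left _ _).trans hsr.le))
    obtain ⟨C, hC⟩ := exists_lipschitzOnWith_zDeriv h₀ h₁ hr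
    have hbound : ∀ ζ ∈ annulus, ∀ z ∈ K,
        ‖zDeriv2 (perronEnvelope (ball 0 1) φ₀ φ₁) ζ z‖ ≤ C := fun ζ hζ z hz =>
      norm_fderiv_le_of_lipschitzOn ℝ (isOpen_ball.mem_nhds (hKr hz))
        ((hC ζ hζ).2.2.mono ball_subset_closedBall)
    refine ⟨C, fun ζ hζ => ⟨(hC ζ hζ).2.2.mono (hKr.trans ball_subset_closedBall), ?_⟩, ?_, ?_⟩
    · rw [ae_restrict_iff' hK.measurableSet]
      exact Eventually.of_forall (hbound ζ hζ)
    · rw [Measure.volume_eq_prod]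
      exact aestronglyMeasurable_zDeriv2 h₀ h₁ volume hr0 hr hK.measurableSet hKr
    · have hle := eLpNorm_zDeriv2_le (E := EuclideanSpace ℂ (Fin n))
        (volume : Measure (EuclideanSpace ℂ (Fin n) × ℂ)) hK.measurableSet hbound
      exact hle
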